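/- Corollary 3 (Tassiulas random policy). Consider a time-slotted network of $N$ switches with a set $\mathcal S\subseteq\{0,1\}^{N\times N}$ of feasible schedules, queues $L(t)=[L_{ij}(t)]$ ($i\ne j$; $L_{ii}\equiv 0$), and reconfiguration delay $\Delta_r$, started from any queue lengths $L(0)$ and any schedule $S(-1)\in\mathcal S$. Here $L_{ij}(t+1)=L_{ij}(t)-D_{ij}(t)+A_{ij}(t)$; if the schedule was changed at some time $k$ with $k\le t\le k+\Delta_r$ (changed at $k$ means $S(k)\neq S(k-1)$), then $D(t)=0$, and otherwise $D_{ij}(t)=S_{ij}(t)\mathbf 1\{L_{ij}(t)>0\}$. The arrivals $A_{ij}(t)\in\mathbb N$ are independent over queues and slots and identically distributed over slots, with finite mean $\lambda_{ij}$. Write $W_S(t)=\sum_{i,j}L_{ij}(t)S_{ij}$ for the weight of a schedule $S$ and $W^*(t)=\max_{S\in\mathcal S}W_S(t)$. The network is strongly stable if $\limsup_{t\to\infty}\frac1t\sum_{\tau<t}\mathbb E\sum_{i,j}L_{ij}(\tau)<\infty$. Traffic is admissible if some scheduling policy (with $S(t)\in\mathcal S$ a function of $A(0),\dots,A(t),S(0),\dots,S(t-1)$)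 makes the network strongly stable; $\Lambda$ is the set of rate matrices of admissible traffic, and the load of $\lambda$ is $\rho(\lambda)=\inf\{r\in(0,1):\lambda\in r\overline{\Lambda}\}$ ($=\infty$ if there is no such $r$). Let $g:[0,\infty)\to[0,\infty)$ be continuous and strictly increasing with $g(x)/x\to0$ and $g(x)\to\infty$ as $x\to\infty$. The Tassiulas random policy selects at each time $t$ a random schedule $Z(t)\in\mathcal S$ and proposes $\Pi(t)=M(t)$ if $W_{M(t)}(t)\ge W_{Z(t)}(t)$ and $\Pi(t)=Z(t)$ otherwise, where $M(t)$ is the last schedule. In its $g$-adaptive variant the network uses $S(t)=S(t-1)$ if $W_{\Pi(t)}(t)-W_{S(t-1)}(t)\le g(W_{\Pi(t)}(t))$ and $S(t)=\Pi(t)$ otherwise. Here $M(t)$ is either the last proposed schedule $\Pi(t-1)$ (with any $\Pi(-1)\in\mathcal S$) or the last employed schedule $S(t-1)$; the claim holds for each choice. Assume that, for some $\varepsilon>0$ and all $t$, the schedule $Z(t)$ is a MaxWeight schedule, $W_{Z(t)}(t)=W^*(t)$, with conditional probability at least $\varepsilon$ given the history $(A(\tau),Z(\tau))_{\tau<t}$,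 and that $A(t)$ is independent of $(A(\tau))_{\tau<t}$ and $(Z(\tau))_{\tau\le t}$ jointly. Then, for every $\Delta_r\in\{0,1,2,\dots\}$, the $g$-adaptive variant of the Tassiulas random policy is throughput optimal: it makes the network strongly stable under all admissible traffic with bounded arrivals ($A_{ij}(t)\le A_{\max}<\infty$ almost surely) and load $\rho(\lambda)<1$. -/

import Mathlib

open MeasureTheory ProbabilityTheory Filter Topology
open scoped ENNReal

universe u

noncomputable section

/-- A schedule: an `N × N` matrix with entries in `{0, 1}` (`true` stands for `1`). -/
abbrev Schedule (N : ℕ) : Type := Fin N → Fin N → Bool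

/-- An `N × N` matrix of packet numbers (queue lengths, or arrivals in a slot). -/
abbrev Packets (N : ℕ) : Type := Fin N → Fin N → ℕ

/-- The weight `⟨L, S⟩ = ∑ i j, L i j * S i j` of a schedule at queue lengths `L`. -/
def weight {N : ℕ} (L : Packets N) (S : Schedule N) : ℝ :=
  ∑ i, ∑ j, if S i j = true then (L i j : ℝ) else 0

/-- `‖L‖`, the total number of queued packets. -/
def totalQueue {N : ℕ} (L : Packets N) : ℕ := ∑ i, ∑ j, L i j

/-- The network: its set of feasible schedules, its reconfiguration delay (in slots), the queue
lengths at time `0`, and the schedule in force just before time `0`. There is no queue from a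
switch to itself. -/
structure Network (N : ℕ) where
  feasible : Set (Schedule N)
  delay : ℕ
  initQueue : Packets N
  initQueue_diag : ∀ i, initQueue i i = 0
  initSched : Schedule N
  initSched_mem : initSched ∈ feasible

/-- The shifted sequence `t ↦ x (t - 1)`, with `x (-1) = x₀`. -/
def prev {α : Type*} (x₀ : α) (x : ℕ → α) : ℕ → α
  | 0 => x₀
  | t + 1 => x t

namespace Network

variable {N : ℕ} (net : Network N)

/-- `S` is a MaxWeight schedule at queue lengths `L`. -/
def IsMaxWeight (L : Packets N) (S : Schedule N) : Prop :=
  S ∈ net.feasible ∧ ∀ S' ∈ net.feasible, weight L S' ≤ weight L S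

/-- The schedule is reconfigured at time `t`. -/
def ReconfiguredAt (S : ℕ → Schedule N) (t : ℕ) : Prop :=
  S t ≠ prev net.initSched S t

/-- Slot `t` is lost: `t = k + τ` with `k` a reconfiguration time and `0 ≤ τ ≤ delay`. -/
def Reconfiguring (S : ℕ → Schedule N) (t : ℕ) : Prop :=
  ∃ k, k ≤ t ∧ t ≤ k + net.delay ∧ net.ReconfiguredAt S k

open Classical in
/-- Departures in slot `t` from queues of lengths `L`. -/
def departures (S : ℕ → Schedule N) (L : Packets N) (t : ℕ) : Packets N :=
  fun i j => if ¬ net.Reconfiguring S t ∧ S t i j = true ∧ 0 < L i j then 1 else 0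

/-- The queue lengths `L(t)` produced by the schedules `S` and the arrivals `A`:
`L(t + 1) = L(t) - D(t) + A(t)`. -/
def queue (S : ℕ → Schedule N) (A : ℕ → Packets N) : ℕ → Packets N
  | 0 => net.initQueue
  | t + 1 => fun i j =>
      queue S A t i j - net.departures S (queue S A t) t i j + A t i j

end Network

/-- The σ-algebra generated by `X 0, …, X (t - 1)`. -/
@[reducible] def past {Ω α : Type*} [MeasurableSpace α] (X : ℕ → Ω → α) (t : ℕ) : MeasurableSpace Ω :=
  ⨆ τ, ⨆ (_ : τ < t), MeasurableSpace.comap (X τ) inferInstance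

/-- Arrival traffic: arrivals are independent over queues and slots, identically distributed over
slots, and have a finite mean; no arrivals from a switch to itself. -/
structure IsArrivalProcess {N : ℕ} {Ω : Type*} [MeasurableSpace Ω] (μ : Measure Ω)
    (A : ℕ → Ω → Packets N) : Prop where
  measurable : ∀ t, Measurable (A t)
  indep : iIndepFun (fun (p : ℕ × Fin N × Fin N) ω => A p.1 ω p.2.1 p.2.2) μ
  identDistrib : ∀ t i j, IdentDistrib (fun ω => A t ω i j) (fun ω => A 0 ω i j) μ μ
  integrable : ∀ i j, Integrable (fun ω => (A 0 ω i j : ℝ)) μ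
  diag : ∀ t ω i, A t ω i i = 0

/-- The arrivals at each queue are bounded by a constant. -/
def BoundedArrivals {N : ℕ} {Ω : Type*} [MeasurableSpace Ω] (μ : Measure Ω)
    (A : ℕ → Ω → Packets N) : Prop :=
  ∃ Amax : ℕ, ∀ t i j, ∀ᵐ ω ∂μ, A t ω i j ≤ Amax

/-- The traffic rate matrix. -/
def trafficRate {N : ℕ} {Ω : Type*} [MeasurableSpace Ω] (μ : Measure Ω)
    (A : ℕ → Ω → Packets N) : Fin N → Fin N → ℝ :=
  fun i j => ∫ ω, (A 0 ω i j : ℝ) ∂μ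

namespace Network

variable {N : ℕ} (net : Network N)

/-- Strong stability: `limsup (1/t) ∑_{τ < t} E ‖L(τ)‖ < ∞`, for the queues produced by the random
schedules `S` and arrivals `A`. -/
def StronglyStable {Ω : Type*} [MeasurableSpace Ω] (μ : Measure Ω)
    (A : ℕ → Ω → Packets N) (S : ℕ → Ω → Schedule N) : Prop :=
  limsup (fun t : ℕ =>
    (∑ τ ∈ Finset.range t,
      ∫⁻ ω, (totalQueue (net.queue (fun s => S s ω) (fun s => A s ω) τ) : ℝ≥0∞) ∂μ) / (t : ℝ≥0∞))
    atTop < ⊤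

/-- The schedules of a scheduling policy: feasible, and `S(t)` is a function of
`A(0), …, A(t), S(0), …, S(t - 1)`. -/
def IsSchedulingPolicy {Ω : Type*} (A : ℕ → Ω → Packets N) (S : ℕ → Ω → Schedule N) : Prop :=
  (∀ t ω, S t ω ∈ net.feasible) ∧ ∀ t, Measurable[past A (t + 1) ⊔ past S t] (S t)

/-- The traffic is admissible: some scheduling policy strongly stabilizes the network. -/
def Admissible {Ω : Type*} [MeasurableSpace Ω] (μ : Measure Ω)
    (A : ℕ → Ω → Packets N) : Prop :=
  ∃ S : ℕ → Ω → Schedule N, net.IsSchedulingPolicy A S ∧ net.StronglyStable μ A S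

/-- The capacity region: the set of the rate matrices of admissible traffic. -/
def capacityRegion : Set (Fin N → Fin N → ℝ) :=
  {r | ∃ (Ω : Type) (_ : MeasurableSpace Ω) (μ : Measure Ω) (A : ℕ → Ω → Packets N),
    IsProbabilityMeasure μ ∧ IsArrivalProcess μ A ∧ net.Admissible μ A ∧ r = trafficRate μ A}

/-- The load `ρ(x) = inf {r : x ∈ r • closure Λ, 0 < r < 1}` of a rate matrix `x`, where `Λ` is the
capacity region; it is `∞` if there is no such `r`. -/
def load (x : Fin N → Fin N → ℝ) : ℝ≥0∞ :=
  ⨅ (r : ℝ) (_ : 0 < r ∧ r < 1 ∧ ∃ y ∈ closure net.capacityRegion, x = r • y), ENNReal.ofReal r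

end Network

/-- A (possibly random) scheduling policy, given by its realizations: it says which schedule
processes `S` on a probability space that carries the arrivals `A` are produced by the policy. -/
abbrev PolicyRealization (N : ℕ) : Type (u + 1) :=
  (Ω : Type u) → [MeasurableSpace Ω] → Measure Ω →
    (ℕ → Ω → Packets N) → (ℕ → Ω → Schedule N) → Prop

/-- Throughput optimality: the policy strongly stabilizes the network under all admissible traffic
of load less than one with bounded arrivals. -/
def ThroughputOptimal {N : ℕ} (net : Network N) (P : PolicyRealization.{u} N) : Prop :=
  ∀ (Ω : Type u) [MeasurableSpace Ω] (μ : Measure Ω) [IsProbabilityMeasure μ]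
    (A : ℕ → Ω → Packets N),
    IsArrivalProcess μ A → BoundedArrivals μ A →
    net.Admissible μ A → net.load (trafficRate μ A) < 1 →
    ∀ S : ℕ → Ω → Schedule N, P Ω μ A S → net.StronglyStable μ A S

/-- A hysteresis function (only its values on `[0, ∞)` matter, as weights are nonnegative). -/
structure IsHysteresis (g : ℝ → ℝ) : Prop where
  nonneg : ∀ x, 0 ≤ x → 0 ≤ g x
  continuousOn : ContinuousOn g (Set.Ici 0)
  strictMonoOn : StrictMonoOn g (Set.Ici 0)
  sublinear : Tendsto (fun x => g x / x) atTop (𝓝 0)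
  tendsto_atTop : Tendsto g atTop atTop

open Classical in
/-- One step of a `g`-adaptive variant: keep the current schedule `s` if
`W_p - W_s ≤ g (W_p)`, otherwise move to the proposed schedule `p`. -/
def adaptiveStep {N : ℕ} (g : ℝ → ℝ) (L : Packets N) (s p : Schedule N) : Schedule N :=
  if weight L p - weight L s ≤ g (weight L p) then s else p

open Classical in
/-- One step of the Tassiulas random policy: the remembered schedule `m` is kept if its weight is
at least that of the randomly selected schedule `z`, otherwise `z` is taken. -/
def tassiulasStep {N : ℕ} (L : Packets N) (m z : Schedule N) : Schedule N :=
  if weight L z ≤ weight L m then m else z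

/-- What the Tassiulas random policy remembers when it is run inside its adaptive variant: the last
schedule `Π(t - 1)` that it proposed itself, or the last schedule `S(t - 1)` of the network. -/
inductive TassiulasMemory
  | proposed
  | employed

/-- The remembered schedule, given the last proposal `p` and the last network schedule `s`. -/
def TassiulasMemory.recall {N : ℕ} (mem : TassiulasMemory) (p s : Schedule N) : Schedule N :=
  match mem with
  | .proposed => p
  | .employed => s

/-- `S` are the network schedules under the `g`-adaptive variant of the Tassiulas random policy,
with randomly selected schedules `Z` and proposed schedules `Q` (`Π(t)` in the usual notation);
`q₀` is the proposal remembered at the start. -/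
structure IsAdaptiveTassiulasRun {N : ℕ} (net : Network N) (g : ℝ → ℝ) (ε : ℝ)
    (mem : TassiulasMemory) {Ω : Type*} [MeasurableSpace Ω] (μ : Measure Ω)
    (A : ℕ → Ω → Packets N) (Z Q : ℕ → Ω → Schedule N) (q₀ : Schedule N)
    (S : ℕ → Ω → Schedule N) : Prop where
  init_mem : q₀ ∈ net.feasible
  select_measurable : ∀ t, Measurable (Z t)
  select_mem : ∀ t ω, Z t ω ∈ net.feasible
  /-- The selections made up to slot `t` do not anticipate the arrivals at the end of slot `t`. -/
  select_indep : ∀ t,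
    Indep (MeasurableSpace.comap (A t) inferInstance) (past A t ⊔ past Z (t + 1)) μ
  /-- Given the history before slot `t`, the selected schedule is a MaxWeight schedule with
  conditional probability at least `ε`. -/
  select_maxWeight : ∀ t (B : Set Ω), MeasurableSet[past A t ⊔ past Z t] B →
    ENNReal.ofReal ε * μ B ≤
      μ (B ∩ {ω | net.IsMaxWeight (net.queue (fun s => S s ω) (fun s => A s ω) t) (Z t ω)})
  proposal : ∀ t ω,
    Q t ω = tassiulasStep (net.queue (fun s => S s ω) (fun s => A s ω) t)
      (mem.recall (prev q₀ (fun s => Q s ω) t) (prev net.initSched (fun s => S s ω) t))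
      (Z t ω)
  schedule : ∀ t ω,
    S t ω = adaptiveStep g (net.queue (fun s => S s ω) (fun s => A s ω) t)
      (prev net.initSched (fun s => S s ω) t) (Q t ω)

/-- The `g`-adaptive variant of the Tassiulas random policy, whose random selection finds a MaxWeight
schedule with probability at least `ε`. -/
def adaptiveTassiulas {N : ℕ} (net : Network N) (g : ℝ → ℝ) (ε : ℝ) (mem : TassiulasMemory) :
    PolicyRealization.{u} N :=
  fun _ _ μ A S => ∃ Z Q q₀, IsAdaptiveTassiulasRun net g ε mem μ A Z Q q₀ S

end

noncomputable section

/-! The proof is a quadratic Lyapunov argument over windows of `T` slots, with `w` the maximal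
weight at the start of a window.

Arrival side: under any stabilizing policy, weighted arrivals cannot outrun the maximal weight that
schedules remove per slot, so a rate matrix of load below one satisfies `⟨L, λ⟩ ≤ r * maxWeight L`
for some `r < 1` and all integer `L` (`exists_pairing_le_of_load_lt_one`). Hence arrivals contribute
at most about `r * T * w` to half the drift.

Service side: three effects keep the departures below `T * w`. Before the first MaxWeight selection
in the window nothing is known about the schedule. Each slot succeeds with conditional probability
at least `ε`, so the expected loss is at most `E w / ε` (`mul_sum_integral_unhitWeight_le`). Once
such a selection occurs, the schedule in use is within `g` of optimal, and sublinearity of `g` makes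
this loss at most `δ * w` per slot, up to a constant. After that, reconfigurations are few: for
large weights every switch gains more than `g`, which exceeds all drift inside the window, so
weights measured at the start of the window increase strictly along switches and no schedule is
entered twice. The number of lost slots is therefore bounded independently of `T`
(`frozen_weight_increases`, `card_changes_le`, `window_deficit`).

Only the loss `δ * T * w` grows with `T`, so with `δ = (1 - r) / 2` and `T` large the drift is at
most `-2 * E w` plus a constant (`exists_window_drift`). Summing over starting times bounds the
average maximal weight, which controls all queues because unserved queues receive no arrivals. -/

lemma ofReal_integral_le_lintegral {Ω : Type*} [MeasurableSpace Ω] {μ : Measure Ω} {f : Ω → ℝ}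
    (hf : Integrable f μ) : ENNReal.ofReal (∫ ω, f ω ∂μ) ≤ ∫⁻ ω, ENNReal.ofReal (f ω) ∂μ := by
  rw [integral_eq_lintegral_pos_part_sub_lintegral_neg_part hf]
  exact ENNReal.ofReal_le_of_le_toReal (sub_le_self _ ENNReal.toReal_nonneg)

/-- The pairing `∑ i j, w i j * x i j` of integer weights with a real matrix. -/
def pairing {N : ℕ} (w : Packets N) (x : Fin N → Fin N → ℝ) : ℝ := ∑ i, ∑ j, (w i j : ℝ) * x i j

/-- The entries of a matrix of packet numbers, as real numbers. -/
def toReal {N : ℕ} (L : Packets N) : Fin N → Fin N → ℝ := fun i j => (L i j : ℝ)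

/-- The Lyapunov function `∑ i j, L i j ^ 2`. -/
def lyapunov {N : ℕ} (L : Packets N) : ℝ := pairing L (toReal L)

lemma weight_nonneg {N : ℕ} (L : Packets N) (s : Schedule N) : 0 ≤ weight L s :=
  Finset.sum_nonneg fun i _ => Finset.sum_nonneg fun j _ => by split_ifs <;> positivity

lemma le_totalQueue {N : ℕ} (L : Packets N) (i j : Fin N) :
    L i j ≤ totalQueue L :=
  (Finset.single_le_sum (f := fun j => L i j) (fun _ _ => Nat.zero_le _) (Finset.mem_univ j)).trans
    (Finset.single_le_sum (f := fun i => ∑ j, L i j) (fun _ _ => Nat.zero_le _)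
      (Finset.mem_univ i))

lemma pairing_toReal_le {N : ℕ} (w L : Packets N) :
    pairing w (toReal L) ≤ (totalQueue w : ℝ) * totalQueue L := by
  have h : (totalQueue w : ℝ) * totalQueue L = ∑ i, ∑ j, (w i j : ℝ) * totalQueue L := by
    simp only [totalQueue, Nat.cast_sum, Finset.sum_mul]
  rw [h]
  refine Finset.sum_le_sum fun i _ => Finset.sum_le_sum fun j _ => ?_
  have := le_totalQueue L i j
  unfold toReal
  gcongr

/-! ### Maximal weights and the queue recursion on a single path -/

namespace Network

variable {N : ℕ} (net : Network N)

/-- The weight of a MaxWeight schedule. -/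
def maxWeight (L : Packets N) : ℝ := ⨆ s : net.feasible, weight L s

lemma weight_le_maxWeight (L : Packets N) {s : Schedule N} (hs : s ∈ net.feasible) :
    weight L s ≤ net.maxWeight L :=
  le_ciSup (f := fun s : net.feasible => weight L s) (Set.finite_range _).bddAbove ⟨s, hs⟩

lemma maxWeight_nonneg (L : Packets N) : 0 ≤ net.maxWeight L :=
  (weight_nonneg L _).trans (net.weight_le_maxWeight L net.initSched_mem)

lemma maxWeight_le {L : Packets N} {x : ℝ} (h : ∀ s ∈ net.feasible, weight L s ≤ x) :
    net.maxWeight L ≤ x :=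
  haveI : Nonempty net.feasible := ⟨⟨_, net.initSched_mem⟩⟩
  ciSup_le fun s => h s s.2

lemma departures_le (S : ℕ → Schedule N) (L : Packets N) (t : ℕ) (i j : Fin N) :
    net.departures S L t i j ≤ L i j := by
  unfold departures
  split_ifs with h
  · exact h.2.2
  · exact Nat.zero_le _

lemma departures_le_one (S : ℕ → Schedule N) (L : Packets N) (t : ℕ) (i j : Fin N) :
    net.departures S L t i j ≤ 1 := by
  unfold departures
  split_ifs <;> simp

lemma queue_succ_cast (S : ℕ → Schedule N) (A : ℕ → Packets N) (t : ℕ) (i j : Fin N) :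
    (net.queue S A (t + 1) i j : ℝ) =
      net.queue S A t i j - net.departures S (net.queue S A t) t i j + A t i j := by
  simp only [queue, Nat.cast_add]
  rw [Nat.cast_sub (net.departures_le S _ t i j)]

lemma pairing_departures_le (w : Packets N) (S : ℕ → Schedule N) (L : Packets N) (t : ℕ) :
    pairing w (toReal (net.departures S L t)) ≤ weight w (S t) := by
  refine Finset.sum_le_sum fun i _ => Finset.sum_le_sum fun j _ => ?_
  simp only [toReal, departures]
  by_cases h : S t i j = true
  · simp only [h, if_true]
    split_ifs <;> simp
  · simp [h]

/-- An empty queue has no departure, but it also adds nothing to the weight, so nothing is lost when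
`L` itself is the weighting. -/
lemma pairing_self_departures (S : ℕ → Schedule N) (L : Packets N) (t : ℕ)
    (h : ¬ net.Reconfiguring S t) :
    pairing L (toReal (net.departures S L t)) = weight L (S t) := by
  refine Finset.sum_congr rfl fun i _ => Finset.sum_congr rfl fun j _ => ?_
  simp only [toReal, departures]
  rcases Nat.eq_zero_or_pos (L i j) with h0 | h0
  · simp [h0]
  · simp [h, h0]

lemma pairing_departures_nonneg (w : Packets N) (S : ℕ → Schedule N) (L : Packets N) (t : ℕ) :
    0 ≤ pairing w (toReal (net.departures S L t)) :=
  Finset.sum_nonneg fun i _ => Finset.sum_nonneg fun j _ => by simp only [toReal]; positivity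

lemma pairing_queue_succ (w : Packets N) (S : ℕ → Schedule N) (A : ℕ → Packets N) (t : ℕ) :
    pairing w (toReal (net.queue S A (t + 1))) =
      pairing w (toReal (net.queue S A t)) -
        pairing w (toReal (net.departures S (net.queue S A t) t)) + pairing w (toReal (A t)) := by
  simp only [pairing, toReal, ← Finset.sum_sub_distrib, ← Finset.sum_add_distrib, queue_succ_cast]
  refine Finset.sum_congr rfl fun i _ => Finset.sum_congr rfl fun j _ => ?_
  ring

/-- Whatever has arrived has either departed, at a weighted rate of at most `maxWeight w` per slot,
or is still queued. -/
lemma sum_pairing_arrivals_le (w : Packets N) (S : ℕ → Schedule N) (A : ℕ → Packets N)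
    (hS : ∀ t, S t ∈ net.feasible) (t : ℕ) :
    ∑ τ ∈ Finset.range t, pairing w (toReal (A τ)) ≤
      t * net.maxWeight w + pairing w (toReal (net.queue S A t)) := by
  induction t with
  | zero =>
    simp only [Finset.range_zero, Finset.sum_empty, Nat.cast_zero, zero_mul, zero_add]
    exact Finset.sum_nonneg fun i _ => Finset.sum_nonneg fun j _ => by
      simp only [toReal]; positivity
  | succ t ih =>
    rw [Finset.sum_range_succ, pairing_queue_succ]
    have h1 := net.pairing_departures_le w S (net.queue S A t) t
    have h2 := net.weight_le_maxWeight w (hS t)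
    push_cast
    linarith

end Network

/-! ### Means of the arrivals -/

section Arrivals

variable {N : ℕ} {Ω : Type*} [MeasurableSpace Ω] {μ : Measure Ω} {A : ℕ → Ω → Packets N}

lemma IsArrivalProcess.identDistrib_cast (hA : IsArrivalProcess μ A) (t : ℕ) (i j : Fin N) :
    IdentDistrib (fun ω => (A t ω i j : ℝ)) (fun ω => (A 0 ω i j : ℝ)) μ μ :=
  (hA.identDistrib t i j).comp (u := fun n : ℕ => (n : ℝ)) measurable_from_top

lemma IsArrivalProcess.integrable_apply (hA : IsArrivalProcess μ A) (t : ℕ) (i j : Fin N) :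
    Integrable (fun ω => (A t ω i j : ℝ)) μ :=
  (hA.identDistrib_cast t i j).integrable_iff.2 (hA.integrable i j)

lemma IsArrivalProcess.integral_apply (hA : IsArrivalProcess μ A) (t : ℕ) (i j : Fin N) :
    ∫ ω, (A t ω i j : ℝ) ∂μ = trafficRate μ A i j :=
  (hA.identDistrib_cast t i j).integral_eq

lemma IsArrivalProcess.integrable_pairing (hA : IsArrivalProcess μ A) (w : Packets N) (t : ℕ) :
    Integrable (fun ω => pairing w (toReal (A t ω))) μ :=
  integrable_finsetSum _ fun i _ => integrable_finsetSum _ fun j _ =>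
    (hA.integrable_apply t i j).const_mul _

lemma IsArrivalProcess.integral_pairing (hA : IsArrivalProcess μ A) (w : Packets N) (t : ℕ) :
    ∫ ω, pairing w (toReal (A t ω)) ∂μ = pairing w (trafficRate μ A) := by
  simp only [pairing, toReal]
  rw [integral_finsetSum _ fun i _ => integrable_finsetSum _ fun j _ =>
    (hA.integrable_apply t i j).const_mul _]
  refine Finset.sum_congr rfl fun i _ => ?_
  rw [integral_finsetSum _ fun j _ => (hA.integrable_apply t i j).const_mul _]
  refine Finset.sum_congr rfl fun j _ => ?_
  rw [integral_const_mul, hA.integral_apply]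

end Arrivals

/-! ### Outer bound for the capacity region -/

namespace Network

variable {N : ℕ} (net : Network N)

/-- The mean of `sum_pairing_arrivals_le`: an excess of the rate forces linear growth of the
expected queue. The queue enters through a lower integral, so neither its measurability nor its
integrability is needed. -/
lemma ofReal_pairing_trafficRate_le {Ω : Type*} [MeasurableSpace Ω] {μ : Measure Ω}
    [IsProbabilityMeasure μ] {A : ℕ → Ω → Packets N} (hA : IsArrivalProcess μ A)
    {S : ℕ → Ω → Schedule N} (hS : ∀ t ω, S t ω ∈ net.feasible) (w : Packets N) (t : ℕ) :
    ENNReal.ofReal (t * (pairing w (trafficRate μ A) - net.maxWeight w)) ≤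
      totalQueue w *
        ∫⁻ ω, (totalQueue (net.queue (fun s => S s ω) (fun s => A s ω) t) : ℝ≥0∞) ∂μ := by
  have hint : ∫ ω, (∑ τ ∈ Finset.range t, pairing w (toReal (A τ ω)) - t * net.maxWeight w) ∂μ =
      t * (pairing w (trafficRate μ A) - net.maxWeight w) := by
    rw [integral_sub (integrable_finsetSum _ fun τ _ => hA.integrable_pairing w τ)
      (integrable_const _), integral_finsetSum _ fun τ _ => hA.integrable_pairing w τ]
    simp [hA.integral_pairing]
    ring
  rw [← hint, ← lintegral_const_mul' _ _ (ENNReal.natCast_ne_top _)]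
  refine (ofReal_integral_le_lintegral ((integrable_finsetSum _ fun τ _ =>
    hA.integrable_pairing w τ).sub (integrable_const _))).trans (lintegral_mono fun ω => ?_)
  have h1 := net.sum_pairing_arrivals_le w (fun s => S s ω) (fun s => A s ω) (fun s => hS s ω) t
  have h2 := pairing_toReal_le w (net.queue (fun s => S s ω) (fun s => A s ω) t)
  refine (ENNReal.ofReal_le_ofReal (q := ((totalQueue w *
    totalQueue (net.queue (fun s => S s ω) (fun s => A s ω) t) : ℕ) : ℝ)) ?_).trans ?_
  · push_cast
    exact sub_le_iff_le_add'.2 (h1.trans (by gcongr))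
  · rw [ENNReal.ofReal_natCast]
    push_cast
    exact le_rfl

/-- An excess `η > 0` would make the expected queue grow linearly, hence its running sum
quadratically, against the linear bound from strong stability. -/
lemma pairing_trafficRate_le_maxWeight {Ω : Type*} [MeasurableSpace Ω] {μ : Measure Ω}
    [IsProbabilityMeasure μ] {A : ℕ → Ω → Packets N} (hA : IsArrivalProcess μ A)
    (h : net.Admissible μ A) (w : Packets N) :
    pairing w (trafficRate μ A) ≤ net.maxWeight w := by
  obtain ⟨S, ⟨hS, -⟩, hst⟩ := h
  by_contra! hlt
  set η := pairing w (trafficRate μ A) - net.maxWeight w with hη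
  have hηpos : 0 < η := sub_pos.2 hlt
  obtain ⟨C, hC, hCtop⟩ := exists_between hst
  have hev := eventually_lt_of_limsup_lt hC
  set ℓ : ℕ → ℝ≥0∞ := fun τ =>
    ∫⁻ ω, (totalQueue (net.queue (fun s => S s ω) (fun s => A s ω) τ) : ℝ≥0∞) ∂μ with hℓ
  have hsum : ∀ t : ℕ, ENNReal.ofReal (η * (t * (t - 1) / 2)) ≤
      totalQueue w * ∑ τ ∈ Finset.range t, ℓ τ := by
    intro t
    have : η * (t * (t - 1) / 2) = ∑ τ ∈ Finset.range t, (τ : ℝ) * η := by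
      induction t with
      | zero => simp
      | succ t ih => rw [Finset.sum_range_succ, ← ih]; push_cast; ring
    rw [this, ENNReal.ofReal_sum_of_nonneg fun τ _ => by positivity, Finset.mul_sum]
    exact Finset.sum_le_sum fun τ _ => net.ofReal_pairing_trafficRate_le hA hS w τ
  have hfin : (totalQueue w : ℝ≥0∞) * C ≠ ⊤ :=
    ENNReal.mul_ne_top (ENNReal.natCast_ne_top _) hCtop.ne
  -- Chosen so that `η * (t - 1) / 2` exceeds `totalQueue w * C` as soon as `t ≥ m + 1`.
  obtain ⟨m, hm⟩ := exists_nat_gt (2 * ((totalQueue w : ℝ≥0∞) * C).toReal / η)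
  obtain ⟨t, ht, htm⟩ := (hev.and (eventually_ge_atTop (m + 1))).exists
  have ht0 : (t : ℝ≥0∞) ≠ 0 := by simp; omega
  have h1 : ∑ τ ∈ Finset.range t, ℓ τ ≤ C * t :=
    (ENNReal.div_le_iff ht0 (ENNReal.natCast_ne_top _)).1 ht.le
  have h2 : ENNReal.ofReal (η * (t * (t - 1) / 2)) ≤ totalQueue w * C * t :=
    (hsum t).trans (by rw [mul_assoc]; gcongr)
  have h3 := ENNReal.toReal_mono (ENNReal.mul_ne_top hfin (ENNReal.natCast_ne_top _)) h2
  have htR : (m : ℝ) + 1 ≤ t := by exact_mod_cast htm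
  have hm0 : (0 : ℝ) ≤ m := Nat.cast_nonneg m
  rw [ENNReal.toReal_ofReal, ENNReal.toReal_mul (a := _ * _), ENNReal.toReal_natCast] at h3
  · rw [div_lt_iff₀ hηpos] at hm
    have h4 : η * (t - 1) / 2 ≤ (totalQueue w * C).toReal := by
      refine le_of_mul_le_mul_right (a := (t : ℝ)) ?_ (by linarith)
      linarith
    nlinarith
  · have : 0 ≤ (t : ℝ) - 1 := by linarith
    positivity

lemma pairing_le_maxWeight_of_mem_closure {y : Fin N → Fin N → ℝ}
    (hy : y ∈ closure net.capacityRegion) (w : Packets N) :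
    pairing w y ≤ net.maxWeight w := by
  have hcl : IsClosed {y : Fin N → Fin N → ℝ | pairing w y ≤ net.maxWeight w} :=
    isClosed_le (by unfold pairing; fun_prop) continuous_const
  refine closure_minimal ?_ hcl hy
  rintro _ ⟨Ω, _, μ, A, _, hA, hadm, rfl⟩
  exact net.pairing_trafficRate_le_maxWeight hA hadm w

/-- A rate matrix of load less than one lies in the interior of the capacity region, as tested by
nonnegative integer weights. -/
lemma exists_pairing_le_of_load_lt_one {x : Fin N → Fin N → ℝ} (h : net.load x < 1) :
    ∃ r : ℝ, 0 < r ∧ r < 1 ∧ ∀ w : Packets N, pairing w x ≤ r * net.maxWeight w := by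
  unfold load at h
  simp only [iInf_lt_iff] at h
  obtain ⟨r, ⟨hr0, hr1, y, hy, rfl⟩, -⟩ := h
  refine ⟨r, hr0, hr1, fun w => ?_⟩
  have : pairing w (r • y) = r * pairing w y := by
    simp only [pairing, Finset.mul_sum, Pi.smul_apply, smul_eq_mul]
    exact Finset.sum_congr rfl fun i _ => Finset.sum_congr rfl fun j _ => by ring
  rw [this]
  exact mul_le_mul_of_nonneg_left (net.pairing_le_maxWeight_of_mem_closure hy w) hr0.le

end Network

/-! ### Few switches once the weight is large -/

section Switching

variable {σ : Type*}

/-- If a function of the state increases strictly at every change of state in the slots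
`a, …, b - 1`, then the number of changes is at most the number of states. -/
lemma card_changes_le [Fintype σ] [DecidableEq σ] {f : σ → ℝ} {S : ℕ → σ} {a b : ℕ}
    (h : ∀ t, a ≤ t → t + 1 < b → S (t + 1) = S t ∨ f (S t) < f (S (t + 1))) :
    ((Finset.Ioo a b).filter fun t => S t ≠ S (t - 1)).card ≤ Fintype.card σ := by
  have hmono : ∀ s t, a ≤ s → s ≤ t → t < b → f (S s) ≤ f (S t) := by
    intro s t has hst
    induction t, hst using Nat.le_induction with
    | base => exact fun _ => le_rfl
    | succ t hst ih =>
      intro htb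
      refine (ih (by omega)).trans ?_
      rcases h t (has.trans hst) htb with h | h
      · rw [h]
      · exact h.le
  -- A change raises `f` strictly above all its earlier values, so the state entered is new; hence
  -- `S` is injective on the change times.
  have key : ∀ s t, a < s → s < t → t < b → S t ≠ S (t - 1) → S s ≠ S t := by
    intro s t has hst htb hne heq
    have h1 := hmono s (t - 1) has.le (by omega) (by omega)
    have h2 := h (t - 1) (by omega) (by omega)
    rw [show t - 1 + 1 = t by omega] at h2
    rcases h2 with h2 | h2
    · exact hne h2
    · rw [heq] at h1
      linarith
  refine Finset.card_le_card_of_injOn S (fun _ _ => Finset.mem_univ _) ?_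
  intro s hs t ht heq
  simp only [Finset.coe_filter, Finset.mem_Ioo, Set.mem_ofPred_eq] at hs ht
  rcases lt_trichotomy s t with hlt | hlt | hlt
  · exact (key s t hs.1.1 hlt ht.1.2 ht.2 heq).elim
  · exact hlt
  · exact (key t s ht.1.1 hlt hs.1.2 hs.2 heq.symm).elim

/-- State weights `W t` that drift by at most `c` from their values `W t₀`; a change to a state has
to improve the weight by more than `g` of the new weight. Once the weight is large, the weight at
time `t₀` of the current state increases strictly at every change. -/
lemma frozen_weight_increases {W : ℕ → σ → ℝ} {S : ℕ → σ} {g : ℝ → ℝ} {t₀ a b : ℕ} {c β y : ℝ}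
    (hg : ∀ x, 0 ≤ x → 0 ≤ g x) (hW : ∀ t s, 0 ≤ W t s)
    (hgy : ∀ x, y ≤ x → 2 * c ≤ g x)
    (hdrift : ∀ t, a ≤ t → t < b → ∀ s, |W t s - W t₀ s| ≤ c)
    (hswitch : ∀ t, S (t + 1) ≠ S t →
      W (t + 1) (S t) + g (W (t + 1) (S (t + 1))) < W (t + 1) (S (t + 1)))
    (hβ : β ≤ W t₀ (S a)) (hy : y ≤ β - c) :
    (∀ t, a ≤ t → t < b → β ≤ W t₀ (S t)) ∧
    ∀ t, a ≤ t → t + 1 < b → S (t + 1) = S t ∨ W t₀ (S t) < W t₀ (S (t + 1)) := by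
  have step : ∀ t, a ≤ t → t + 1 < b → β ≤ W t₀ (S t) →
      S (t + 1) = S t ∨ W t₀ (S t) < W t₀ (S (t + 1)) := by
    intro t hat htb hbt
    by_cases hS : S (t + 1) = S t
    · exact Or.inl hS
    right
    have h1 := hswitch t hS
    have h2 := abs_le.1 (hdrift (t + 1) (by omega) htb (S t))
    have h3 := abs_le.1 (hdrift (t + 1) (by omega) htb (S (t + 1)))
    have h4 := hg _ (hW (t + 1) (S (t + 1)))
    -- The new weight exceeds that of the old state, which is at least `β - c ≥ y`. So `g` there is
    -- at least `2 * c`, covering the drift of both states since `t₀`.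
    have h5 := hgy (W (t + 1) (S (t + 1))) (by linarith)
    linarith
  have inv : ∀ t, a ≤ t → t < b → β ≤ W t₀ (S t) := by
    intro t hat
    induction t, hat using Nat.le_induction with
    | base => exact fun _ => hβ
    | succ t hat ih =>
      intro htb
      have hb := ih (by omega)
      rcases step t hat htb hb with h | h
      · rwa [h]
      · exact hb.trans h.le
  exact ⟨inv, fun t hat htb => step t hat htb (inv t hat (by omega))⟩

end Switching

/-! ### Path estimates over a window -/

namespace Network

variable {N : ℕ} (net : Network N)

/-- The slots in `(a, b)` that are lost through reconfigurations. -/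
lemma card_reconfiguring_le {S : ℕ → Schedule N} {f : Schedule N → ℝ} {a b : ℕ}
    (h : ∀ t, a ≤ t → t + 1 < b → S (t + 1) = S t ∨ f (S t) < f (S (t + 1)))
    {F : Finset ℕ} (hF : ∀ t ∈ F, a < t ∧ t < b ∧ net.Reconfiguring S t) :
    F.card ≤ (Fintype.card (Schedule N) + 1) * (net.delay + 1) := by
  -- The point `a` stands for all reconfigurations at or before `a`: a slot after `a` that they
  -- still block lies in `[a, a + delay]`.
  set K := insert a ((Finset.Ioo a b).filter fun t => S t ≠ S (t - 1)) with hK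
  have hsub : F ⊆ K.biUnion fun k => Finset.Icc k (k + net.delay) := by
    intro t ht
    obtain ⟨hat, htb, k, hkt, htk, hk⟩ := hF t ht
    rw [Finset.mem_biUnion]
    by_cases hka : k ≤ a
    · exact ⟨a, Finset.mem_insert_self _ _, Finset.mem_Icc.2 ⟨hat.le, by omega⟩⟩
    · refine ⟨k, Finset.mem_insert_of_mem (Finset.mem_filter.2
        ⟨Finset.mem_Ioo.2 ⟨by omega, by omega⟩, ?_⟩), Finset.mem_Icc.2 ⟨hkt, htk⟩⟩
      obtain ⟨k, rfl⟩ : ∃ k', k = k' + 1 := ⟨k - 1, by omega⟩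
      exact hk
  refine (Finset.card_le_card hsub).trans ((Finset.card_biUnion_le_card_mul _ _ (net.delay + 1)
    fun k _ => ?_).trans ?_)
  · simp; omega
  · gcongr
    exact (Finset.card_insert_le _ _).trans (Nat.succ_le_succ (card_changes_le h))

section Path

variable {S : ℕ → Schedule N} {A : ℕ → Packets N} {Amax : ℕ}

lemma abs_queue_succ_sub_le (hA : ∀ t i j, A t i j ≤ Amax) (t : ℕ) (i j : Fin N) :
    |(net.queue S A (t + 1) i j : ℝ) - net.queue S A t i j| ≤ 1 + Amax := by
  rw [queue_succ_cast]
  have h1 : (A t i j : ℝ) ≤ Amax := by exact_mod_cast hA t i j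
  have h2 : (net.departures S (net.queue S A t) t i j : ℝ) ≤ 1 := by
    exact_mod_cast net.departures_le_one S _ t i j
  have h3 : (0 : ℝ) ≤ A t i j := Nat.cast_nonneg _
  have h4 : (0 : ℝ) ≤ net.departures S (net.queue S A t) t i j := Nat.cast_nonneg _
  rw [abs_le]
  constructor <;> linarith

/-- A bound for the change of the weight of a schedule in a slot. -/
def slotDrift (N Amax : ℕ) : ℝ := N * (N * (1 + Amax))

lemma slotDrift_nonneg (N Amax : ℕ) : 0 ≤ slotDrift N Amax := by unfold slotDrift; positivity

lemma abs_weight_queue_succ_sub_le (hA : ∀ t i j, A t i j ≤ Amax) (t : ℕ) (s : Schedule N) :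
    |weight (net.queue S A (t + 1)) s - weight (net.queue S A t) s| ≤ slotDrift N Amax := by
  simp only [weight, ← Finset.sum_sub_distrib]
  calc _ ≤ ∑ _i : Fin N, ∑ _j : Fin N, (1 + Amax : ℝ) := by
        refine (Finset.abs_sum_le_sum_abs _ _).trans (Finset.sum_le_sum fun i _ =>
          (Finset.abs_sum_le_sum_abs _ _).trans (Finset.sum_le_sum fun j _ => ?_))
        split_ifs
        · exact net.abs_queue_succ_sub_le hA t i j
        · rw [sub_zero, abs_zero]; positivity
    _ = _ := by simp only [slotDrift, Finset.sum_const, Finset.card_univ, Fintype.card_fin, nsmul_eq_mul]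

lemma abs_weight_queue_add_sub_le (hA : ∀ t i j, A t i j ≤ Amax) (t m : ℕ) (s : Schedule N) :
    |weight (net.queue S A (t + m)) s - weight (net.queue S A t) s| ≤ m * slotDrift N Amax := by
  induction m with
  | zero => simp
  | succ m ih =>
    have h := net.abs_weight_queue_succ_sub_le (S := S) hA (t + m) s
    rw [abs_le] at *
    rw [← add_assoc]
    push_cast
    constructor <;> linarith

lemma abs_weight_queue_window (hA : ∀ t i j, A t i j ≤ Amax) {t₀ T t : ℕ} (h₀ : t₀ ≤ t)
    (h₁ : t < t₀ + T) (s : Schedule N) :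
    |weight (net.queue S A t) s - weight (net.queue S A t₀) s| ≤ T * slotDrift N Amax := by
  obtain ⟨m, rfl⟩ := Nat.exists_eq_add_of_le h₀
  refine (net.abs_weight_queue_add_sub_le hA t₀ m s).trans ?_
  have : (m : ℝ) ≤ T := by exact_mod_cast (by omega : m ≤ T)
  exact mul_le_mul_of_nonneg_right this (slotDrift_nonneg _ _)

lemma maxWeight_queue_window_le (hA : ∀ t i j, A t i j ≤ Amax) {t₀ T t : ℕ} (h₀ : t₀ ≤ t)
    (h₁ : t < t₀ + T) :
    net.maxWeight (net.queue S A t) ≤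
      net.maxWeight (net.queue S A t₀) + T * slotDrift N Amax := by
  refine net.maxWeight_le fun s hs => ?_
  have h1 := abs_le.1 (net.abs_weight_queue_window (S := S) hA h₀ h₁ s)
  have h2 := net.weight_le_maxWeight (net.queue S A t₀) hs
  linarith

lemma maxWeight_le_queue_window (hA : ∀ t i j, A t i j ≤ Amax) {t₀ T t : ℕ} (h₀ : t₀ ≤ t)
    (h₁ : t < t₀ + T) :
    net.maxWeight (net.queue S A t₀) ≤
      net.maxWeight (net.queue S A t) + T * slotDrift N Amax := by
  refine net.maxWeight_le fun s hs => ?_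
  have h1 := abs_le.1 (net.abs_weight_queue_window (S := S) hA h₀ h₁ s)
  have h2 := net.weight_le_maxWeight (net.queue S A t) hs
  linarith

/-- Expand `y ^ 2 = x ^ 2 + 2 * x * (y - x) + (y - x) ^ 2` in each queue; the last term is at most
`(1 + Amax) ^ 2`. -/
lemma lyapunov_queue_succ_le (hA : ∀ t i j, A t i j ≤ Amax) (t : ℕ) :
    lyapunov (net.queue S A (t + 1)) ≤ lyapunov (net.queue S A t) +
      2 * pairing (net.queue S A t) (toReal (A t)) -
      2 * pairing (net.queue S A t) (toReal (net.departures S (net.queue S A t) t)) +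
      N * (N * (1 + Amax) ^ 2) := by
  have hc : (N * (N * (1 + Amax) ^ 2) : ℝ) = ∑ _i : Fin N, ∑ _j : Fin N, (1 + Amax : ℝ) ^ 2 := by
    simp
  rw [hc]
  simp only [lyapunov, pairing, toReal, Finset.mul_sum, ← Finset.sum_sub_distrib,
    ← Finset.sum_add_distrib]
  refine Finset.sum_le_sum fun i _ => Finset.sum_le_sum fun j _ => ?_
  have h := sq_le_sq' (abs_le.1 (net.abs_queue_succ_sub_le (S := S) hA t i j)).1
    (abs_le.1 (net.abs_queue_succ_sub_le (S := S) hA t i j)).2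
  have h2 := net.queue_succ_cast S A t i j
  have h3 : (net.departures S (net.queue S A t) t i j : ℝ) =
    net.queue S A t i j + A t i j - net.queue S A (t + 1) i j := by linarith
  rw [h3]
  nlinarith

lemma lyapunov_queue_add_le (hA : ∀ t i j, A t i j ≤ Amax) (t₀ T : ℕ) :
    lyapunov (net.queue S A (t₀ + T)) ≤ lyapunov (net.queue S A t₀) +
      2 * ∑ m ∈ Finset.range T, pairing (net.queue S A (t₀ + m)) (toReal (A (t₀ + m))) -
      2 * ∑ m ∈ Finset.range T, pairing (net.queue S A (t₀ + m))
        (toReal (net.departures S (net.queue S A (t₀ + m)) (t₀ + m))) +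
      T * (N * (N * (1 + Amax) ^ 2)) := by
  induction T with
  | zero => simp
  | succ T ih =>
    have h := net.lyapunov_queue_succ_le (S := S) hA (t₀ + T)
    rw [Finset.sum_range_succ, Finset.sum_range_succ, ← add_assoc]
    push_cast
    linarith

end Path

end Network

/-! ### Hysteresis and the deficit of service in a window -/

lemma IsHysteresis.exists_le_mul_add {g : ℝ → ℝ} (hg : IsHysteresis g) {δ : ℝ} (hδ : 0 < δ) :
    ∃ C, 0 ≤ C ∧ ∀ x, 0 ≤ x → g x ≤ δ * x + C := by
  obtain ⟨X, hX⟩ := ((hg.sublinear.eventually_lt_const hδ).and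
    (eventually_ge_atTop 1)).exists_forall_of_atTop
  have hX0 : 0 ≤ X := zero_le_one.trans (hX X le_rfl).2
  refine ⟨g X, hg.nonneg X hX0, fun x hx => ?_⟩
  rcases le_total x X with h | h
  · have h1 := hg.strictMonoOn.monotoneOn hx hX0 h
    have h2 : 0 ≤ δ * x := by positivity
    linarith
  · obtain ⟨h1, h2⟩ := hX x h
    rw [div_lt_iff₀ (by linarith)] at h1
    linarith [hg.nonneg X hX0]

lemma IsHysteresis.exists_forall_le {g : ℝ → ℝ} (hg : IsHysteresis g) (c : ℝ) :
    ∃ y, ∀ x, y ≤ x → c ≤ g x := by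
  obtain ⟨y, hy⟩ := (hg.tendsto_atTop.eventually_ge_atTop c).exists_forall_of_atTop
  exact ⟨y, hy⟩

namespace Network

variable {N : ℕ} (net : Network N)

/-- The properties of a run of an adaptive policy on which its stability rests: the network moves
to another schedule only if this improves the weight by more than `g` of the new weight, and in
the slots `hit` the schedule is within `g` of one of maximal weight. -/
structure IsAdaptivePath (g : ℝ → ℝ) (S : ℕ → Schedule N) (A : ℕ → Packets N)
    (hit : ℕ → Prop) : Prop where
  switch : ∀ t, S (t + 1) ≠ S t →
    weight (net.queue S A (t + 1)) (S t) + g (weight (net.queue S A (t + 1)) (S (t + 1))) <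
      weight (net.queue S A (t + 1)) (S (t + 1))
  of_hit : ∀ t, hit t → ∃ p, net.maxWeight (net.queue S A t) ≤ weight (net.queue S A t) p ∧
    weight (net.queue S A t) p - g (weight (net.queue S A t) p) ≤ weight (net.queue S A t) (S t)

/-- The number of slots of a window that reconfigurations after the first hit can cost. -/
def switchingCost : ℕ := (Fintype.card (Schedule N) + 1) * (net.delay + 1)

open Classical in
/-- The total departure weight over a window falls short of its maximum by little more than the
weight lost before the first hit. -/
lemma window_deficit {g : ℝ → ℝ} (hg : IsHysteresis g) {δ : ℝ} (hδ : 0 < δ) (hδ1 : δ < 1)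
    (T Amax : ℕ) :
    ∃ C : ℝ, ∀ (S : ℕ → Schedule N) (A : ℕ → Packets N) (hit : ℕ → Prop),
      (∀ t i j, A t i j ≤ Amax) → net.IsAdaptivePath g S A hit → ∀ t₀ : ℕ,
      T * net.maxWeight (net.queue S A t₀) -
        ∑ m ∈ Finset.range T, pairing (net.queue S A (t₀ + m))
          (toReal (net.departures S (net.queue S A (t₀ + m)) (t₀ + m))) ≤
      ∑ m ∈ Finset.range T,
        (if ∀ j < m, ¬ hit (t₀ + j) then net.maxWeight (net.queue S A t₀) else 0) +
        (net.switchingCost + T * δ) * net.maxWeight (net.queue S A t₀) + C := by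
  obtain ⟨Cδ, hCδ, hgδ⟩ := hg.exists_le_mul_add hδ
  set c : ℝ := T * slotDrift N Amax with hc
  have hc0 : 0 ≤ c := mul_nonneg (Nat.cast_nonneg _) (slotDrift_nonneg _ _)
  obtain ⟨y, hy⟩ := hg.exists_forall_le (2 * c)
  -- Below `X` the whole deficit is at most `T * X` and goes into the constant. Above it, the
  -- starting weight `(1 - δ) * w - Cδ - 2 * c` still exceeds `y` by at least `c`, as
  -- `frozen_weight_increases` requires.
  set X := max ((y + Cδ + 3 * c) / (1 - δ)) 0 with hX
  refine ⟨T * X + T * (Cδ + 3 * c), fun S A hit hA hpath t₀ => ?_⟩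
  set w := net.maxWeight (net.queue S A t₀) with hw
  have hw0 : 0 ≤ w := net.maxWeight_nonneg _
  have hX0 : 0 ≤ X := le_max_right _ _
  have hT0 : (0 : ℝ) ≤ T := Nat.cast_nonneg _
  have hsum0 : 0 ≤ ∑ m ∈ Finset.range T, (if ∀ j < m, ¬ hit (t₀ + j) then w else 0) :=
    Finset.sum_nonneg fun m _ => by split_ifs <;> simp [hw0]
  have hD0 : 0 ≤ ∑ m ∈ Finset.range T, pairing (net.queue S A (t₀ + m))
      (toReal (net.departures S (net.queue S A (t₀ + m)) (t₀ + m))) :=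
    Finset.sum_nonneg fun m _ => net.pairing_departures_nonneg _ _ _ _
  have hκ0 : 0 ≤ (net.switchingCost + T * δ) * w := by positivity
  have hC0 : 0 ≤ T * (Cδ + 3 * c) := by positivity
  rcases lt_or_ge w X with hwX | hwX
  · have : T * w ≤ T * X := mul_le_mul_of_nonneg_left hwX.le hT0
    linarith
  have hTX : 0 ≤ T * X := by positivity
  by_cases hex : ∃ j, j < T ∧ hit (t₀ + j)
  swap
  · push Not at hex
    have : ∑ m ∈ Finset.range T, (if ∀ j < m, ¬ hit (t₀ + j) then w else 0) = T * w := by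
      rw [Finset.sum_congr rfl fun m hm => if_pos fun j hj =>
        hex j (hj.trans (Finset.mem_range.1 hm))]
      simp
    linarith
  have hjT := (Nat.find_spec hex).1
  have hj := (Nat.find_spec hex).2
  have hjmin : ∀ i, i < T → hit (t₀ + i) → Nat.find hex ≤ i := fun i h1 h2 =>
    Nat.find_min' hex ⟨h1, h2⟩
  generalize Nat.find hex = j₀ at hjT hj hjmin
  have hδ' : 0 < 1 - δ := sub_pos.2 hδ1
  have hwy : y + Cδ + 3 * c ≤ (1 - δ) * w := by
    have := (le_max_left _ _).trans hwX
    rw [div_le_iff₀ hδ'] at this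
    linarith
  have hdrift : ∀ t, t₀ ≤ t → t < t₀ + T → ∀ s,
      |weight (net.queue S A t) s - weight (net.queue S A t₀) s| ≤ c :=
    fun t h0 h1 s => net.abs_weight_queue_window hA h0 h1 s
  -- One `c` pays for the drift of the maximal weight up to the hit, the other for moving the weight
  -- of the current schedule back to `t₀`.
  have hstart : (1 - δ) * w - Cδ - 2 * c ≤ weight (net.queue S A t₀) (S (t₀ + j₀)) := by
    obtain ⟨p, hp1, hp2⟩ := hpath.of_hit _ hj
    have h1 := hgδ _ (weight_nonneg (net.queue S A (t₀ + j₀)) p)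
    have h2 : w ≤ _ + c := net.maxWeight_le_queue_window hA (show t₀ ≤ t₀ + j₀ by omega)
      (show t₀ + j₀ < t₀ + T by omega)
    have h3 := abs_le.1 (hdrift (t₀ + j₀) (by omega) (by omega) (S (t₀ + j₀)))
    have h4 : (1 - δ) * (w - c) ≤ (1 - δ) * weight (net.queue S A (t₀ + j₀)) p :=
      mul_le_mul_of_nonneg_left (by linarith) hδ'.le
    have h5 : 0 ≤ δ * c := by positivity
    linarith
  obtain ⟨hinv, hinc⟩ := frozen_weight_increases (W := fun t => weight (net.queue S A t))
    (t₀ := t₀) (a := t₀ + j₀) (b := t₀ + T) hg.nonneg (fun t s => weight_nonneg _ s) hy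
    (fun t h0 h1 s => hdrift t (by omega) h1 s) hpath.switch hstart (by linarith)
  -- The inequality `j₀ < m` is strict: the slot of the first hit is still charged to the unhit sum,
  -- which looks only at earlier slots.
  set F := (Finset.range T).filter fun m => j₀ < m ∧ net.Reconfiguring S (t₀ + m) with hF
  have hFcard : F.card ≤ net.switchingCost := by
    rw [← Finset.card_image_of_injective F (add_right_injective t₀)]
    refine net.card_reconfiguring_le hinc fun t ht => ?_
    obtain ⟨m, hm, rfl⟩ := Finset.mem_image.1 ht
    obtain ⟨hm1, hm2, hm3⟩ := Finset.mem_filter.1 hm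
    exact ⟨by simpa using hm2, by simpa using hm1, hm3⟩
  have hterm : ∀ m ∈ Finset.range T, w - pairing (net.queue S A (t₀ + m))
      (toReal (net.departures S (net.queue S A (t₀ + m)) (t₀ + m))) ≤
      (if ∀ j < m, ¬ hit (t₀ + j) then w else 0) + (if m ∈ F then w else 0) +
        (δ * w + (Cδ + 3 * c)) := by
    intro m hm
    have hd := net.pairing_departures_nonneg (net.queue S A (t₀ + m)) S
      (net.queue S A (t₀ + m)) (t₀ + m)
    have hδw : 0 ≤ δ * w := by positivity
    by_cases h1 : ∀ j < m, ¬ hit (t₀ + j)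
    · rw [if_pos h1]
      have : 0 ≤ if m ∈ F then w else 0 := by split_ifs <;> simp [hw0]
      linarith
    rw [if_neg h1]
    push Not at h1
    obtain ⟨j, hjm, hj'⟩ := h1
    have hmT := Finset.mem_range.1 hm
    have hj₀m : j₀ < m := (hjmin j (hjm.trans hmT) hj').trans_lt hjm
    by_cases h2 : net.Reconfiguring S (t₀ + m)
    · rw [if_pos (Finset.mem_filter.2 ⟨hm, hj₀m, h2⟩)]
      linarith
    · rw [net.pairing_self_departures _ _ _ h2]
      have : 0 ≤ if m ∈ F then w else 0 := by split_ifs <;> simp [hw0]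
      have h3 := hinv (t₀ + m) (by omega) (by omega)
      have h4 := abs_le.1 (hdrift (t₀ + m) (by omega) (by omega) (S (t₀ + m)))
      linarith
  have hFsum : ∑ m ∈ Finset.range T, (if m ∈ F then w else 0) ≤ net.switchingCost * w := by
    rw [← Finset.sum_filter, Finset.sum_const, nsmul_eq_mul]
    refine mul_le_mul_of_nonneg_right ?_ hw0
    refine le_trans ?_ (Nat.cast_le.2 hFcard)
    exact Nat.cast_le.2 (Finset.card_le_card fun m hm => (Finset.mem_filter.1 hm).2)
  have := Finset.sum_le_sum hterm
  simp only [Finset.sum_sub_distrib, Finset.sum_add_distrib, Finset.sum_const,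
    Finset.card_range, nsmul_eq_mul] at this
  linarith

-- Combines the quadratic expansion with the deficit bound; the arrival term is kept, since it is
-- estimated only in mean.
open Classical in
lemma lyapunov_window_le {g : ℝ → ℝ} (hg : IsHysteresis g) {δ : ℝ} (hδ : 0 < δ) (hδ1 : δ < 1)
    (T Amax : ℕ) :
    ∃ C : ℝ, ∀ (S : ℕ → Schedule N) (A : ℕ → Packets N) (hit : ℕ → Prop),
      (∀ t i j, A t i j ≤ Amax) → net.IsAdaptivePath g S A hit → ∀ t₀ : ℕ,
      lyapunov (net.queue S A (t₀ + T)) ≤ lyapunov (net.queue S A t₀) +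
        2 * ∑ m ∈ Finset.range T, pairing (net.queue S A (t₀ + m)) (toReal (A (t₀ + m))) +
        2 * ∑ m ∈ Finset.range T,
          (if ∀ j < m, ¬ hit (t₀ + j) then net.maxWeight (net.queue S A t₀) else 0) +
        2 * (net.switchingCost + T * δ - T) * net.maxWeight (net.queue S A t₀) + C := by
  obtain ⟨C, hC⟩ := net.window_deficit hg hδ hδ1 T Amax
  refine ⟨2 * C + T * (N * (N * (1 + Amax) ^ 2)), fun S A hit hA hpath t₀ => ?_⟩
  have h1 := hC S A hit hA hpath t₀
  have h2 := net.lyapunov_queue_add_le (S := S) hA t₀ T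
  linarith

end Network

/-! ### Measurability with respect to the past, and conditional probability -/

section Measurability

variable {Ω α β : Type*} [MeasurableSpace α] [MeasurableSpace β]

/-- Every preimage under `X` is the preimage under `H` of some set, and all sets are measurable in a
discrete space. -/
lemma measurable_of_factorsThrough [DiscreteMeasurableSpace α] {m : MeasurableSpace Ω}
    {H : Ω → α} {X : Ω → β} (hH : Measurable[m] H) (h : ∀ ω ω', H ω = H ω' → X ω = X ω') :
    Measurable[m] X := by
  intro B _
  have : X ⁻¹' B = H ⁻¹' (H '' (X ⁻¹' B)) := by
    refine Set.Subset.antisymm (Set.subset_preimage_image _ _) ?_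
    rintro ω ⟨ω', h', heq⟩
    rw [Set.mem_preimage, ← h _ _ heq]
    exact h'
  rw [this]
  exact hH (MeasurableSet.of_discrete)

lemma comap_le_past {X : ℕ → Ω → α} {τ t : ℕ} (h : τ < t) :
    MeasurableSpace.comap (X τ) inferInstance ≤ past X t :=
  le_iSup₂ (f := fun τ (_ : τ < t) => MeasurableSpace.comap (X τ) inferInstance) τ h

lemma past_mono (X : ℕ → Ω → α) {s t : ℕ} (h : s ≤ t) : past X s ≤ past X t :=
  iSup₂_le fun _ hτ => comap_le_past (hτ.trans_le h)

lemma past_le [m : MeasurableSpace Ω] {X : ℕ → Ω → α} (hX : ∀ t, Measurable (X t)) (t : ℕ) :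
    past X t ≤ m :=
  iSup₂_le fun τ _ => (hX τ).comap_le

/-- A function that depends only on the history of two discrete processes is measurable with
respect to their past. -/
lemma measurable_past_of_history [Countable α] [MeasurableSingletonClass α] [Countable β]
    [MeasurableSingletonClass β] {γ : Type*} [MeasurableSpace γ] {X : ℕ → Ω → α} {Y : ℕ → Ω → β}
    {t : ℕ} {f : Ω → γ}
    (h : ∀ ω ω', (∀ τ < t, X τ ω = X τ ω' ∧ Y τ ω = Y τ ω') → f ω = f ω') :
    Measurable[past X t ⊔ past Y t] f := by
  refine measurable_of_factorsThrough (m := past X t ⊔ past Y t)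
    (H := fun ω (τ : Fin t) => (X τ ω, Y τ ω)) ?_ ?_
  · refine @measurable_pi_lambda _ _ _ (past X t ⊔ past Y t) _ _ fun τ => ?_
    refine @Measurable.prodMk _ (past X t ⊔ past Y t) _ _ _ _ _ _ ?_ ?_
    · exact measurable_iff_comap_le.2 ((comap_le_past τ.2).trans le_sup_left)
    · exact measurable_iff_comap_le.2 ((comap_le_past τ.2).trans le_sup_right)
  · intro ω ω' heq
    refine h ω ω' fun τ hτ => ?_
    have := congrFun heq ⟨τ, hτ⟩
    exact Prod.mk.inj this

/-- If `H` has conditional probability at least `ε` given `m`, then the mean of a nonnegative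
`m`-measurable function over `H` is at least `ε` times its mean. -/
lemma mul_integral_le_setIntegral {m m₀ : MeasurableSpace Ω} (hm : m ≤ m₀) {μ : Measure Ω}
    {H : Set Ω} {ε : ℝ} (hε : 0 ≤ ε)
    (h : ∀ B, MeasurableSet[m] B → ENNReal.ofReal ε * μ B ≤ μ (B ∩ H)) {f : Ω → ℝ}
    (hf : Measurable[m] f) (hf0 : ∀ ω, 0 ≤ f ω) (hfi : Integrable f μ) :
    ε * ∫ ω, f ω ∂μ ≤ ∫ ω in H, f ω ∂μ := by
  -- On the sub-σ-algebra the hypothesis is an inequality of measures, so it passes to integrals of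
  -- nonnegative functions.
  have hle : ENNReal.ofReal ε • μ.trim hm ≤ (μ.restrict H).trim hm := by
    refine Measure.le_iff.2 fun B hB => ?_
    rw [Measure.smul_apply, trim_measurableSet_eq hm hB, trim_measurableSet_eq hm hB,
      Measure.restrict_apply (hm _ hB)]
    exact h B hB
  have hfm : Measurable[m] fun ω => ENNReal.ofReal (f ω) := ENNReal.measurable_ofReal.comp hf
  have h1 : ENNReal.ofReal ε * ∫⁻ ω, ENNReal.ofReal (f ω) ∂μ ≤
      ∫⁻ ω in H, ENNReal.ofReal (f ω) ∂μ := by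
    rw [← lintegral_trim hm hfm, ← lintegral_trim hm hfm, ← smul_eq_mul, ← lintegral_smul_measure]
    exact lintegral_mono' hle le_rfl
  rw [← ofReal_integral_eq_lintegral_ofReal hfi (ae_of_all _ hf0),
    ← ofReal_integral_eq_lintegral_ofReal hfi.restrict (ae_of_all _ hf0),
    ← ENNReal.ofReal_mul hε] at h1
  exact (ENNReal.ofReal_le_ofReal_iff (integral_nonneg hf0)).1 h1

end Measurability

/-! ### Causality and growth of the queues -/

namespace Network

variable {N : ℕ} (net : Network N)

lemma departures_congr {S S' : ℕ → Schedule N} {t : ℕ} (h : ∀ τ ≤ t, S τ = S' τ)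
    (L : Packets N) : net.departures S L t = net.departures S' L t := by
  have hrec : ∀ k ≤ t, (net.ReconfiguredAt S k ↔ net.ReconfiguredAt S' k) := by
    intro k hk
    unfold ReconfiguredAt
    cases k with
    | zero => simp [prev, h 0 hk]
    | succ k => simp [prev, h (k + 1) hk, h k (by omega)]
  have : net.Reconfiguring S t ↔ net.Reconfiguring S' t := by
    unfold Reconfiguring
    exact exists_congr fun k => and_congr_right fun hk => and_congr_right fun _ => hrec k hk
  funext i j
  classical
  exact if_congr (by rw [this, h t le_rfl]) rfl rfl

lemma queue_le {S : ℕ → Schedule N} {A : ℕ → Packets N} {Amax : ℕ} {i j : Fin N}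
    (hA : ∀ t, A t i j ≤ Amax) (t : ℕ) :
    net.queue S A t i j ≤ net.initQueue i j + t * Amax := by
  induction t with
  | zero => simp [queue]
  | succ t ih =>
    have := hA t
    simp only [queue]
    rw [Nat.succ_mul]
    omega

end Network

lemma adaptiveStep_cases {N : ℕ} (g : ℝ → ℝ) (L : Packets N) (s p : Schedule N) :
    adaptiveStep g L s p = s ∧ weight L p - weight L s ≤ g (weight L p) ∨
      adaptiveStep g L s p = p ∧ g (weight L p) < weight L p - weight L s := by
  unfold adaptiveStep
  split_ifs with h
  · exact Or.inl ⟨rfl, h⟩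
  · exact Or.inr ⟨rfl, not_le.1 h⟩

lemma weight_le_weight_tassiulasStep {N : ℕ} (L : Packets N) (m z : Schedule N) :
    weight L z ≤ weight L (tassiulasStep L m z) := by
  unfold tassiulasStep
  split_ifs with h
  · exact h
  · exact le_rfl

/-! ### The random run: dependence on the past, integrability, and the wait for a hit -/

namespace IsAdaptiveTassiulasRun

section Defs

variable {N : ℕ} {Ω : Type*}

/-- The queue lengths of the run. -/
abbrev queues (net : Network N) (A : ℕ → Ω → Packets N) (S : ℕ → Ω → Schedule N) (t : ℕ) (ω : Ω) :
    Packets N :=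
  net.queue (fun s => S s ω) (fun s => A s ω) t

open Classical in
/-- The maximal weight at the start of a window, as long as no MaxWeight schedule was selected in
the first `m` slots of the window. -/
def unhitWeight (net : Network N) (A : ℕ → Ω → Packets N) (Z S : ℕ → Ω → Schedule N)
    (t₀ m : ℕ) (ω : Ω) : ℝ :=
  if ∀ j < m, ¬ net.IsMaxWeight (queues net A S (t₀ + j) ω) (Z (t₀ + j) ω) then
    net.maxWeight (queues net A S t₀ ω) else 0

lemma unhitWeight_nonneg (net : Network N) (A : ℕ → Ω → Packets N) (Z S : ℕ → Ω → Schedule N)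
    (t₀ m : ℕ) (ω : Ω) : 0 ≤ unhitWeight net A Z S t₀ m ω := by
  unfold unhitWeight
  split_ifs
  · exact net.maxWeight_nonneg _
  · exact le_rfl

end Defs

variable {N : ℕ} {net : Network N} {g : ℝ → ℝ} {ε : ℝ} {mem : TassiulasMemory} {Ω : Type*}
  [MeasurableSpace Ω] {μ : Measure Ω} {A : ℕ → Ω → Packets N} {Z Q : ℕ → Ω → Schedule N}
  {q₀ : Schedule N} {S : ℕ → Ω → Schedule N}

/-- The proposal is at least as heavy as `Z`, whatever schedule is remembered. This is why both
kinds of memory are covered at once. -/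
lemma isAdaptivePath (h : IsAdaptiveTassiulasRun net g ε mem μ A Z Q q₀ S)
    (hg : IsHysteresis g) (ω : Ω) :
    net.IsAdaptivePath g (fun s => S s ω) (fun s => A s ω)
      (fun t => net.IsMaxWeight (queues net A S t ω) (Z t ω)) where
  switch t ht := by
    rcases adaptiveStep_cases g (queues net A S (t + 1) ω) (S t ω) (Q (t + 1) ω) with
      ⟨h1, -⟩ | ⟨h1, h2⟩
    · exact absurd ((h.schedule (t + 1) ω).trans h1) ht
    · simp only [(h.schedule (t + 1) ω).trans h1]
      linarith
  of_hit t ht := by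
    refine ⟨Q t ω, (net.maxWeight_le ht.2).trans ?_, ?_⟩
    · rw [h.proposal t ω]
      exact weight_le_weight_tassiulasStep _ _ _
    · have hgQ := hg.nonneg _ (weight_nonneg (queues net A S t ω) (Q t ω))
      rcases adaptiveStep_cases g (queues net A S t ω) (prev net.initSched (fun s => S s ω) t)
        (Q t ω) with ⟨h1, h2⟩ | ⟨h1, -⟩
      · simp only [(h.schedule t ω).trans h1]
        linarith
      · simp only [(h.schedule t ω).trans h1]
        linarith

/-- The selections are the only randomness of the policy, so the run is a function of past arrivals
and selections; all measurability of queues and schedules comes from this. -/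
lemma determined (h : IsAdaptiveTassiulasRun net g ε mem μ A Z Q q₀ S) {ω ω' : Ω} {t : ℕ}
    (hAZ : ∀ τ < t, A τ ω = A τ ω' ∧ Z τ ω = Z τ ω') :
    (∀ τ < t, Q τ ω = Q τ ω' ∧ S τ ω = S τ ω') ∧ queues net A S t ω = queues net A S t ω' := by
  induction t with
  | zero => exact ⟨fun τ hτ => absurd hτ (Nat.not_lt_zero _), rfl⟩
  | succ t ih =>
    obtain ⟨ih1, ih2⟩ := ih fun τ hτ => hAZ τ (by omega)
    have hprev : prev q₀ (fun s => Q s ω) t = prev q₀ (fun s => Q s ω') t ∧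
        prev net.initSched (fun s => S s ω) t = prev net.initSched (fun s => S s ω') t := by
      cases t with
      | zero => exact ⟨rfl, rfl⟩
      | succ t => exact ih1 t (by omega)
    have hL : net.queue (fun s => S s ω) (fun s => A s ω) t =
      net.queue (fun s => S s ω') (fun s => A s ω') t := ih2
    have hQ : Q t ω = Q t ω' := by
      rw [h.proposal t ω, h.proposal t ω', hL, hprev.1, hprev.2, (hAZ t (by omega)).2]
    have hS : S t ω = S t ω' := by
      rw [h.schedule t ω, h.schedule t ω', hL, hprev.2, hQ]
    have hall : ∀ τ < t + 1, Q τ ω = Q τ ω' ∧ S τ ω = S τ ω' := by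
      intro τ hτ
      rcases Nat.lt_succ_iff_lt_or_eq.1 hτ with h1 | rfl
      · exact ih1 τ h1
      · exact ⟨hQ, hS⟩
    refine ⟨hall, ?_⟩
    have hd := net.departures_congr (S := fun s => S s ω) (S' := fun s => S s ω') (t := t)
      (fun τ hτ => (hall τ (by omega)).2) (net.queue (fun s => S s ω') (fun s => A s ω') t)
    simp only [queues, Network.queue, hL, hd, (hAZ t (by omega)).1]

lemma queues_eq (h : IsAdaptiveTassiulasRun net g ε mem μ A Z Q q₀ S) {ω ω' : Ω} {s t : ℕ}
    (hst : s ≤ t) (hAZ : ∀ τ < t, A τ ω = A τ ω' ∧ Z τ ω = Z τ ω') :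
    queues net A S s ω = queues net A S s ω' :=
  (h.determined fun τ hτ => hAZ τ (hτ.trans_le hst)).2

lemma measurable_past_comp_queues (h : IsAdaptiveTassiulasRun net g ε mem μ A Z Q q₀ S)
    {γ : Type*} [MeasurableSpace γ] (t : ℕ) (f : Packets N → γ) :
    Measurable[past A t ⊔ past Z t] fun ω => f (queues net A S t ω) :=
  measurable_past_of_history fun _ _ hAZ => by rw [h.queues_eq le_rfl hAZ]

lemma history_le (h : IsAdaptiveTassiulasRun net g ε mem μ A Z Q q₀ S)
    (hA : IsArrivalProcess μ A) (t : ℕ) : past A t ⊔ past Z t ≤ ‹MeasurableSpace Ω› :=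
  sup_le (past_le hA.measurable t) (past_le h.select_measurable t)

lemma measurable_comp_queues (h : IsAdaptiveTassiulasRun net g ε mem μ A Z Q q₀ S)
    (hA : IsArrivalProcess μ A) {γ : Type*} [MeasurableSpace γ] (t : ℕ) (f : Packets N → γ) :
    Measurable fun ω => f (queues net A S t ω) :=
  (h.measurable_past_comp_queues t f).mono (h.history_le hA t) le_rfl

/-- With bounded arrivals the queues at a fixed time lie almost surely in a finite box, on which any
function is bounded. -/
lemma integrable_comp_queues [IsProbabilityMeasure μ]
    (h : IsAdaptiveTassiulasRun net g ε mem μ A Z Q q₀ S)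
    (hA : IsArrivalProcess μ A) {Amax : ℕ} (hb : ∀ᵐ ω ∂μ, ∀ t i j, A t ω i j ≤ Amax) (t : ℕ)
    (f : Packets N → ℝ) : Integrable (fun ω => f (queues net A S t ω)) μ := by
  obtain ⟨C, hC⟩ := ((Set.finite_Icc (0 : Packets N)
    (fun i j => net.initQueue i j + t * Amax)).image fun L => ‖f L‖).bddAbove
  refine Integrable.of_bound (h.measurable_comp_queues hA t f).aestronglyMeasurable C ?_
  filter_upwards [hb] with ω hω
  exact hC ⟨_, ⟨fun i j => Nat.zero_le _, fun i j => net.queue_le (fun t => hω t i j) t⟩, rfl⟩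

/-- The queues at `t` are determined by the history before `t`, of which `A t` is independent, so
each mean of a product factorizes. -/
lemma integral_pairing_arrivals [IsProbabilityMeasure μ]
    (h : IsAdaptiveTassiulasRun net g ε mem μ A Z Q q₀ S)
    (hA : IsArrivalProcess μ A) {Amax : ℕ} (hb : ∀ᵐ ω ∂μ, ∀ t i j, A t ω i j ≤ Amax) (t : ℕ) :
    Integrable (fun ω => pairing (queues net A S t ω) (toReal (A t ω))) μ ∧
    ∫ ω, pairing (queues net A S t ω) (toReal (A t ω)) ∂μ =
      ∫ ω, pairing (queues net A S t ω) (trafficRate μ A) ∂μ := by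
  have hind : ∀ i j, IndepFun (fun ω => (queues net A S t ω i j : ℝ))
      (fun ω => (A t ω i j : ℝ)) μ := by
    intro i j
    rw [IndepFun_iff_Indep]
    refine indep_of_indep_of_le_left (indep_of_indep_of_le_right (h.select_indep t).symm ?_) ?_
    · exact Measurable.comap_le (measurable_of_factorsThrough
        (comap_measurable (A t)) fun ω ω' heq => by rw [heq])
    · exact (Measurable.comap_le
        (h.measurable_past_comp_queues t fun L => (L i j : ℝ))).trans
        (sup_le_sup_left (past_mono Z t.le_succ) _)
  have hLi : ∀ i j, Integrable (fun ω => (queues net A S t ω i j : ℝ)) μ := fun i j =>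
    h.integrable_comp_queues hA hb t fun L => (L i j : ℝ)
  have hi : ∀ i j, Integrable (fun ω => (queues net A S t ω i j : ℝ) * (A t ω i j : ℝ)) μ :=
    fun i j => (hind i j).integrable_mul (hLi i j) (hA.integrable_apply t i j)
  refine ⟨integrable_finsetSum _ fun i _ => integrable_finsetSum _ fun j _ => hi i j, ?_⟩
  simp only [pairing, toReal]
  rw [integral_finsetSum _ fun i _ => integrable_finsetSum _ fun j _ => hi i j,
    integral_finsetSum _ fun i _ => integrable_finsetSum _ fun j _ => (hLi i j).mul_const _]
  refine Finset.sum_congr rfl fun i _ => ?_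
  rw [integral_finsetSum _ fun j _ => hi i j,
    integral_finsetSum _ fun j _ => (hLi i j).mul_const _]
  refine Finset.sum_congr rfl fun j _ => ?_
  rw [(hind i j).integral_fun_mul_eq_mul_integral (hLi i j).aestronglyMeasurable
    (hA.integrable_apply t i j).aestronglyMeasurable, integral_mul_const, hA.integral_apply]

/-- Only selections strictly before slot `t₀ + m` enter, so the conditional bound for the selection
in that slot applies to this function. -/
lemma measurable_unhitWeight (h : IsAdaptiveTassiulasRun net g ε mem μ A Z Q q₀ S) (t₀ m : ℕ) :
    Measurable[past A (t₀ + m) ⊔ past Z (t₀ + m)] (unhitWeight net A Z S t₀ m) := by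
  refine measurable_past_of_history fun ω ω' hAZ => ?_
  have h1 : (∀ j < m, ¬ net.IsMaxWeight (queues net A S (t₀ + j) ω) (Z (t₀ + j) ω)) ↔
      ∀ j < m, ¬ net.IsMaxWeight (queues net A S (t₀ + j) ω') (Z (t₀ + j) ω') :=
    forall₂_congr fun j hj => by
      rw [h.queues_eq (by omega : t₀ + j ≤ t₀ + m) hAZ, (hAZ (t₀ + j) (by omega)).2]
  classical
  exact if_congr h1 (by rw [h.queues_eq (by omega : t₀ ≤ t₀ + m) hAZ]) rfl

lemma integrable_unhitWeight [IsProbabilityMeasure μ]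
    (h : IsAdaptiveTassiulasRun net g ε mem μ A Z Q q₀ S)
    (hA : IsArrivalProcess μ A) {Amax : ℕ} (hb : ∀ᵐ ω ∂μ, ∀ t i j, A t ω i j ≤ Amax)
    (t₀ m : ℕ) : Integrable (unhitWeight net A Z S t₀ m) μ := by
  refine (h.integrable_comp_queues hA hb t₀ net.maxWeight).mono'
    ((h.measurable_unhitWeight t₀ m).mono (h.history_le hA _) le_rfl).aestronglyMeasurable
    (ae_of_all _ fun ω => ?_)
  rw [Real.norm_of_nonneg (unhitWeight_nonneg net A Z S t₀ m ω)]
  unfold unhitWeight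
  split_ifs
  · exact le_rfl
  · exact net.maxWeight_nonneg _

/-- The decrease from `m` to `m + 1` is the mass on the event of a hit in slot `t₀ + m`, which
carries at least the fraction `ε`. -/
lemma mul_integral_unhitWeight_le [IsProbabilityMeasure μ] (hε : 0 ≤ ε)
    (h : IsAdaptiveTassiulasRun net g ε mem μ A Z Q q₀ S)
    (hA : IsArrivalProcess μ A) {Amax : ℕ} (hb : ∀ᵐ ω ∂μ, ∀ t i j, A t ω i j ≤ Amax)
    (t₀ m : ℕ) :
    ε * ∫ ω, unhitWeight net A Z S t₀ m ω ∂μ ≤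
      ∫ ω, unhitWeight net A Z S t₀ m ω ∂μ - ∫ ω, unhitWeight net A Z S t₀ (m + 1) ω ∂μ := by
  set H := {ω | net.IsMaxWeight (queues net A S (t₀ + m) ω) (Z (t₀ + m) ω)} with hH
  have hHm : MeasurableSet H := by
    have : Measurable[past A (t₀ + m + 1) ⊔ past Z (t₀ + m + 1)] fun ω =>
        net.IsMaxWeight (queues net A S (t₀ + m) ω) (Z (t₀ + m) ω) :=
      measurable_past_of_history fun ω ω' hAZ => by
        rw [h.queues_eq (by omega : t₀ + m ≤ t₀ + m + 1) hAZ, (hAZ (t₀ + m) (by omega)).2]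
    exact measurableSet_setOfPred.2 (this.mono (h.history_le hA _) le_rfl)
  have hi := h.integrable_unhitWeight hA hb t₀ m
  have h1 := mul_integral_le_setIntegral (h.history_le hA (t₀ + m)) hε
    (h.select_maxWeight (t₀ + m)) (h.measurable_unhitWeight t₀ m) (unhitWeight_nonneg net A Z S t₀ m)
    hi
  have h2 : ∫ ω, unhitWeight net A Z S t₀ (m + 1) ω ∂μ =
      ∫ ω in Hᶜ, unhitWeight net A Z S t₀ m ω ∂μ := by
    rw [← integral_indicator hHm.compl]
    congr 1 with ω
    by_cases hω : ω ∈ H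
    · rw [Set.indicator_of_notMem (by simpa using hω)]
      classical
      exact if_neg fun hall => hall m (by omega) hω
    · rw [Set.indicator_of_mem hω]
      unfold unhitWeight
      classical
      refine if_congr ?_ rfl rfl
      refine ⟨fun hall j hj => hall j (by omega), fun hall j hj => ?_⟩
      rcases Nat.lt_succ_iff_lt_or_eq.1 hj with hj | rfl
      · exact hall j hj
      · exact hω
  have h3 := integral_add_compl hHm hi
  rw [h2]
  exact h1.trans (by linarith)

/-- Telescoping makes the bound independent of `T`: the expected wait for a hit costs at most `1 /
ε` slots of full weight. -/
lemma mul_sum_integral_unhitWeight_le [IsProbabilityMeasure μ] (hε : 0 ≤ ε)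
    (h : IsAdaptiveTassiulasRun net g ε mem μ A Z Q q₀ S)
    (hA : IsArrivalProcess μ A) {Amax : ℕ} (hb : ∀ᵐ ω ∂μ, ∀ t i j, A t ω i j ≤ Amax)
    (t₀ T : ℕ) :
    ε * ∑ m ∈ Finset.range T, ∫ ω, unhitWeight net A Z S t₀ m ω ∂μ ≤
      ∫ ω, net.maxWeight (queues net A S t₀ ω) ∂μ := by
  have h1 := Finset.sum_le_sum fun m (_ : m ∈ Finset.range T) =>
    h.mul_integral_unhitWeight_le hε hA hb t₀ m
  rw [Finset.sum_range_sub', ← Finset.mul_sum] at h1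
  have h2 : 0 ≤ ∫ ω, unhitWeight net A Z S t₀ T ω ∂μ :=
    integral_nonneg (unhitWeight_nonneg net A Z S t₀ T)
  have h3 : ∫ ω, unhitWeight net A Z S t₀ 0 ω ∂μ =
      ∫ ω, net.maxWeight (queues net A S t₀ ω) ∂μ := by simp [unhitWeight]
  linarith

end IsAdaptiveTassiulasRun

/-! ### From drift to strong stability -/

lemma integral_affine_combination {Ω : Type*} [MeasurableSpace Ω] {μ : Measure Ω}
    [IsProbabilityMeasure μ] {f₁ f₂ f₃ f₄ : Ω → ℝ} (h₁ : Integrable f₁ μ) (h₂ : Integrable f₂ μ)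
    (h₃ : Integrable f₃ μ) (h₄ : Integrable f₄ μ) {a b c C : ℝ} :
    ∫ ω, (f₁ ω + a * f₂ ω + b * f₃ ω + c * f₄ ω + C) ∂μ =
      ∫ ω, f₁ ω ∂μ + a * ∫ ω, f₂ ω ∂μ + b * ∫ ω, f₃ ω ∂μ + c * ∫ ω, f₄ ω ∂μ + C := by
  rw [integral_add (by fun_prop) (by fun_prop), integral_add (by fun_prop) (by fun_prop),
    integral_add (by fun_prop) (by fun_prop), integral_add (by fun_prop) (by fun_prop)]
  simp [integral_const_mul]

lemma pairing_single {N : ℕ} (i j : Fin N) (x : Fin N → Fin N → ℝ) :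
    pairing (fun i' j' => if i' = i ∧ j' = j then 1 else 0) x = x i j := by
  simp [pairing, ite_and]

lemma le_weight {N : ℕ} (L : Packets N) {s : Schedule N} {i j : Fin N} (h : s i j = true) :
    (L i j : ℝ) ≤ weight L s := by
  have h0 : ∀ i j, 0 ≤ if s i j = true then (L i j : ℝ) else 0 := fun i j => by
    split_ifs <;> positivity
  calc (L i j : ℝ) = if s i j = true then (L i j : ℝ) else 0 := by rw [if_pos h]
    _ ≤ ∑ j, if s i j = true then (L i j : ℝ) else 0 :=
      Finset.single_le_sum (f := fun j => if s i j = true then (L i j : ℝ) else 0)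
        (fun j _ => h0 i j) (Finset.mem_univ j)
    _ ≤ weight L s :=
      Finset.single_le_sum (f := fun i => ∑ j, if s i j = true then (L i j : ℝ) else 0)
        (fun i _ => Finset.sum_nonneg fun j _ => h0 i j) (Finset.mem_univ i)

lemma lyapunov_nonneg {N : ℕ} (L : Packets N) : 0 ≤ lyapunov L := by
  unfold lyapunov pairing
  exact Finset.sum_nonneg fun i _ => Finset.sum_nonneg fun j _ => by simp only [toReal]; positivity

/-- Nonnegative `V` whose increase over windows of fixed length is at most `C - 2 * w`: the sums of
`w` grow at most linearly. -/
lemma sum_le_of_window_drift {V w : ℕ → ℝ} {C : ℝ} {T : ℕ} (hV : ∀ t, 0 ≤ V t)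
    (h : ∀ t, V (t + T) ≤ V t - 2 * w t + C) (n : ℕ) :
    2 * ∑ t ∈ Finset.range n, w t ≤ n * C + ∑ t ∈ Finset.range T, V t := by
  have h1 := Finset.sum_le_sum fun t (_ : t ∈ Finset.range n) => h t
  simp only [Finset.sum_add_distrib, Finset.sum_sub_distrib, ← Finset.mul_sum, Finset.sum_const,
    Finset.card_range, nsmul_eq_mul] at h1
  -- Windows start at every slot and overlap, so telescoping leaves the first `T` values of `V`.
  have h2 : ∑ t ∈ Finset.range n, V t ≤ ∑ t ∈ Finset.range (T + n), V t :=
    Finset.sum_le_sum_of_subset_of_nonneg (Finset.range_mono (Nat.le_add_left _ _))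
      fun t _ _ => hV t
  rw [Finset.sum_range_add] at h2
  simp only [add_comm T] at h2
  linarith

namespace Network

variable {N : ℕ} (net : Network N)

/-- A queue that no feasible schedule serves has no arrivals, if the load is less than one. -/
lemma ae_arrival_eq_zero {Ω : Type*} [MeasurableSpace Ω] {μ : Measure Ω}
    {A : ℕ → Ω → Packets N} (hA : IsArrivalProcess μ A) {r : ℝ}
    (hr : ∀ w : Packets N, pairing w (trafficRate μ A) ≤ r * net.maxWeight w) {i j : Fin N}
    (hij : ∀ s ∈ net.feasible, ¬ s i j = true) (t : ℕ) : ∀ᵐ ω ∂μ, A t ω i j = 0 := by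
  -- No feasible schedule collects this unit weight, so the capacity bound tested on it forces the
  -- mean arrival rate at `(i, j)` to vanish.
  set w : Packets N := fun i' j' => if i' = i ∧ j' = j then 1 else 0 with hw
  have h1 : net.maxWeight w = 0 := by
    refine le_antisymm (net.maxWeight_le fun s hs => ?_) (net.maxWeight_nonneg _)
    refine le_of_eq (Finset.sum_eq_zero fun i' _ => Finset.sum_eq_zero fun j' _ => ?_)
    split_ifs with h
    · have : ¬ (i' = i ∧ j' = j) := by
        rintro ⟨rfl, rfl⟩
        exact hij s hs h
      simp [hw, this]
    · rfl
  have h2 := hr w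
  rw [h1, mul_zero, pairing_single, ← hA.integral_apply t] at h2
  have h3 := (integral_eq_zero_iff_of_nonneg (fun ω => Nat.cast_nonneg _)
    (hA.integrable_apply t i j)).1 (le_antisymm h2 (integral_nonneg fun ω => Nat.cast_nonneg _))
  filter_upwards [h3] with ω hω
  simpa using hω

/-- A queue served by some feasible schedule is at most the maximal weight; any other queue never
exceeds its initial length. -/
lemma totalQueue_queue_le {S : ℕ → Schedule N} {A : ℕ → Packets N}
    (hA : ∀ i j, (∀ s ∈ net.feasible, ¬ s i j = true) → ∀ t, A t i j = 0) (t : ℕ) :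
    (totalQueue (net.queue S A t) : ℝ) ≤
      N * (N * (net.maxWeight (net.queue S A t) + totalQueue net.initQueue)) := by
  have h : ∀ i j, (net.queue S A t i j : ℝ) ≤
      net.maxWeight (net.queue S A t) + totalQueue net.initQueue := by
    intro i j
    have h0 := net.maxWeight_nonneg (net.queue S A t)
    by_cases hij : ∃ s ∈ net.feasible, s i j = true
    · obtain ⟨s, hs, hsij⟩ := hij
      have h1 := le_weight (net.queue S A t) hsij
      have h2 := net.weight_le_maxWeight (net.queue S A t) hs
      have h3 : (0 : ℝ) ≤ totalQueue net.initQueue := Nat.cast_nonneg _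
      linarith
    · push Not at hij
      have h1 := net.queue_le (S := S) (Amax := 0) (fun t => (hA i j hij t).le) t
      have h2 : net.queue S A t i j ≤ totalQueue net.initQueue :=
        h1.trans (by simpa using le_totalQueue net.initQueue i j)
      have h3 : (net.queue S A t i j : ℝ) ≤ totalQueue net.initQueue := by exact_mod_cast h2
      linarith
  unfold totalQueue at *
  push_cast at *
  refine (Finset.sum_le_sum fun i _ => Finset.sum_le_sum fun j _ => h i j).trans (le_of_eq ?_)
  simp only [Finset.sum_const, Finset.card_univ, Fintype.card_fin, nsmul_eq_mul]

lemma stronglyStable_of_sum_integral_le {Ω : Type*} [MeasurableSpace Ω] {μ : Measure Ω}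
    {A : ℕ → Ω → Packets N} {S : ℕ → Ω → Schedule N}
    (hint : ∀ t, Integrable
      (fun ω => (totalQueue (net.queue (fun s => S s ω) (fun s => A s ω) t) : ℝ)) μ)
    {a b : ℝ} (hb : 0 ≤ b) (h : ∀ n : ℕ, ∑ t ∈ Finset.range n,
      ∫ ω, (totalQueue (net.queue (fun s => S s ω) (fun s => A s ω) t) : ℝ) ∂μ ≤ n * a + b) :
    net.StronglyStable μ A S := by
  refine lt_of_le_of_lt (limsup_le_of_le (a := ENNReal.ofReal (a + b)) (by isBoundedDefault) ?_)
    ENNReal.ofReal_lt_top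
  filter_upwards [eventually_ge_atTop 1] with n hn
  have hn1 : (1 : ℝ) ≤ n := by exact_mod_cast hn
  refine ENNReal.div_le_of_le_mul ?_
  have h1 : ∀ t, ∫⁻ ω, (totalQueue (net.queue (fun s => S s ω) (fun s => A s ω) t) : ℝ≥0∞) ∂μ =
      ENNReal.ofReal
        (∫ ω, (totalQueue (net.queue (fun s => S s ω) (fun s => A s ω) t) : ℝ) ∂μ) := by
    intro t
    rw [ofReal_integral_eq_lintegral_ofReal (hint t) (ae_of_all _ fun ω => Nat.cast_nonneg _)]
    simp only [ENNReal.ofReal_natCast]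
  have h0 : ∀ t, 0 ≤ ∫ ω, (totalQueue (net.queue (fun s => S s ω) (fun s => A s ω) t) : ℝ) ∂μ :=
    fun t => integral_nonneg fun ω => Nat.cast_nonneg _
  simp only [h1]
  rw [← ENNReal.ofReal_sum_of_nonneg fun t _ => h0 t, ← ENNReal.ofReal_natCast (n := n),
    ← ENNReal.ofReal_mul' (Nat.cast_nonneg n)]
  refine ENNReal.ofReal_le_ofReal ((h n).trans ?_)
  nlinarith

end Network

namespace IsAdaptiveTassiulasRun

variable {N : ℕ} {net : Network N} {g : ℝ → ℝ} {ε : ℝ} {mem : TassiulasMemory} {Ω : Type*}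
  [MeasurableSpace Ω] {μ : Measure Ω} {A : ℕ → Ω → Packets N} {Z Q : ℕ → Ω → Schedule N}
  {q₀ : Schedule N} {S : ℕ → Ω → Schedule N}

/-- The Lyapunov drift over windows of a fixed length is negative for large queues. -/
lemma exists_window_drift [IsProbabilityMeasure μ]
    (h : IsAdaptiveTassiulasRun net g ε mem μ A Z Q q₀ S) (hg : IsHysteresis g) (hε : 0 < ε)
    (hA : IsArrivalProcess μ A) {Amax : ℕ} (hb : ∀ᵐ ω ∂μ, ∀ t i j, A t ω i j ≤ Amax)
    {r : ℝ} (hr0 : 0 < r) (hr1 : r < 1)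
    (hr : ∀ w : Packets N, pairing w (trafficRate μ A) ≤ r * net.maxWeight w) :
    ∃ (T : ℕ) (C : ℝ), ∀ t₀, ∫ ω, lyapunov (queues net A S (t₀ + T) ω) ∂μ ≤
      ∫ ω, lyapunov (queues net A S t₀ ω) ∂μ -
        2 * ∫ ω, net.maxWeight (queues net A S t₀ ω) ∂μ + C := by
  set δ := (1 - r) / 2 with hδ
  have hδ0 : 0 < δ := by linarith
  obtain ⟨T, hT⟩ := exists_nat_ge ((net.switchingCost + 1 / ε + 1) / δ)
  rw [div_le_iff₀ hδ0] at hT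
  obtain ⟨C, hC⟩ := net.lyapunov_window_le hg hδ0 (by linarith) T Amax
  set c := T * Network.slotDrift N Amax with hc
  refine ⟨T, 2 * (T * (r * c)) + C, fun t₀ => ?_⟩
  set w := ∫ ω, net.maxWeight (queues net A S t₀ ω) ∂μ with hw
  have hw0 : 0 ≤ w := integral_nonneg fun ω => net.maxWeight_nonneg _
  have hVi := fun t => h.integrable_comp_queues hA hb t lyapunov
  have hwi := fun t => h.integrable_comp_queues hA hb t net.maxWeight
  have hpi := fun t => (h.integral_pairing_arrivals hA hb t).1
  have hui := fun m => h.integrable_unhitWeight hA hb t₀ m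
  have hsp : Integrable (fun ω => ∑ m ∈ Finset.range T,
      pairing (queues net A S (t₀ + m) ω) (toReal (A (t₀ + m) ω))) μ :=
    integrable_finsetSum _ fun m _ => hpi (t₀ + m)
  have hsu : Integrable (fun ω => ∑ m ∈ Finset.range T, unhitWeight net A Z S t₀ m ω) μ :=
    integrable_finsetSum _ fun m _ => hui m
  have hmain : ∫ ω, lyapunov (queues net A S (t₀ + T) ω) ∂μ ≤
      ∫ ω, lyapunov (queues net A S t₀ ω) ∂μ +
        2 * ∑ m ∈ Finset.range T,
          ∫ ω, pairing (queues net A S (t₀ + m) ω) (toReal (A (t₀ + m) ω)) ∂μ +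
        2 * ∑ m ∈ Finset.range T, ∫ ω, unhitWeight net A Z S t₀ m ω ∂μ +
        2 * (net.switchingCost + T * δ - T) * w + C := by
    have h1 : ∫ ω, lyapunov (queues net A S (t₀ + T) ω) ∂μ ≤
        ∫ ω, (lyapunov (queues net A S t₀ ω) +
          2 * (∑ m ∈ Finset.range T,
            pairing (queues net A S (t₀ + m) ω) (toReal (A (t₀ + m) ω))) +
          2 * (∑ m ∈ Finset.range T, unhitWeight net A Z S t₀ m ω) +
          2 * (net.switchingCost + T * δ - T) * net.maxWeight (queues net A S t₀ ω) + C) ∂μ := by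
      refine integral_mono_ae (hVi _) (((((hVi t₀).add (hsp.const_mul 2)).add
        (hsu.const_mul 2)).add ((hwi t₀).const_mul _)).add (integrable_const C)) ?_
      filter_upwards [hb] with ω hω
      exact hC _ _ _ hω (h.isAdaptivePath hg ω) t₀
    refine h1.trans (le_of_eq ?_)
    rw [integral_affine_combination (hVi t₀) hsp hsu (hwi t₀),
      integral_finsetSum _ fun m _ => hpi (t₀ + m), integral_finsetSum _ fun m _ => hui m]
  have hp : ∀ m ∈ Finset.range T,
      ∫ ω, pairing (queues net A S (t₀ + m) ω) (toReal (A (t₀ + m) ω)) ∂μ ≤ r * (w + c) := by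
    intro m hm
    rw [(h.integral_pairing_arrivals hA hb (t₀ + m)).2]
    have h1 : ∫ ω, pairing (queues net A S (t₀ + m) ω) (trafficRate μ A) ∂μ ≤
        ∫ ω, r * (net.maxWeight (queues net A S t₀ ω) + c) ∂μ := by
      refine integral_mono_ae
        (h.integrable_comp_queues hA hb (t₀ + m) fun L => pairing L (trafficRate μ A))
        (((hwi t₀).add (integrable_const c)).const_mul r) ?_
      filter_upwards [hb] with ω hω
      refine (hr _).trans (mul_le_mul_of_nonneg_left ?_ hr0.le)
      exact net.maxWeight_queue_window_le hω (Nat.le_add_right _ _)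
        (Nat.add_lt_add_left (Finset.mem_range.1 hm) _)
    refine h1.trans (le_of_eq ?_)
    rw [integral_const_mul, integral_add (hwi t₀) (integrable_const c)]
    simp [hw]
  have hp' := Finset.sum_le_sum hp
  simp only [Finset.sum_const, Finset.card_range, nsmul_eq_mul] at hp'
  have hu : ∑ m ∈ Finset.range T, ∫ ω, unhitWeight net A Z S t₀ m ω ∂μ ≤ 1 / ε * w := by
    have := h.mul_sum_integral_unhitWeight_le hε.le hA hb t₀ T
    rw [one_div, inv_mul_eq_div, le_div_iff₀ hε]
    linarith
  have hfin : (net.switchingCost + 1 / ε + 1) * w ≤ T * δ * w :=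
    mul_le_mul_of_nonneg_right hT hw0
  have hδr : (T : ℝ) * δ * w = (T * w - T * (r * w)) / 2 := by rw [hδ]; ring
  linarith

theorem stronglyStable [IsProbabilityMeasure μ]
    (h : IsAdaptiveTassiulasRun net g ε mem μ A Z Q q₀ S) (hg : IsHysteresis g) (hε : 0 < ε)
    (hA : IsArrivalProcess μ A) (hbdd : BoundedArrivals μ A)
    (hload : net.load (trafficRate μ A) < 1) : net.StronglyStable μ A S := by
  obtain ⟨Amax, hAmax⟩ := hbdd
  have hb : ∀ᵐ ω ∂μ, ∀ t i j, A t ω i j ≤ Amax := by simpa only [ae_all_iff] using hAmax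
  obtain ⟨r, hr0, hr1, hr⟩ := net.exists_pairing_le_of_load_lt_one hload
  have hz : ∀ᵐ ω ∂μ, ∀ i j, (∀ s ∈ net.feasible, ¬ s i j = true) → ∀ t, A t ω i j = 0 := by
    simp only [ae_all_iff]
    exact fun i j hij t => net.ae_arrival_eq_zero hA hr hij t
  obtain ⟨T, C, hdrift⟩ := h.exists_window_drift hg hε hA hb hr0 hr1 hr
  have hsum := sum_le_of_window_drift
    (fun t => integral_nonneg fun ω => lyapunov_nonneg (queues net A S t ω)) hdrift
  set V₀ := ∑ t ∈ Finset.range T, ∫ ω, lyapunov (queues net A S t ω) ∂μ with hV₀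
  have hV₀nonneg : 0 ≤ V₀ :=
    Finset.sum_nonneg fun t _ => integral_nonneg fun ω => lyapunov_nonneg _
  have hwi := fun t => h.integrable_comp_queues hA hb t net.maxWeight
  have hqi := fun t => h.integrable_comp_queues hA hb t fun L => (totalQueue L : ℝ)
  refine net.stronglyStable_of_sum_integral_le (a := N * (N * (C / 2 + totalQueue net.initQueue)))
    (b := N * (N * (V₀ / 2))) hqi (by positivity) fun n => ?_
  have hq : ∀ t ∈ Finset.range n, ∫ ω, (totalQueue (queues net A S t ω) : ℝ) ∂μ ≤
      N * (N * (∫ ω, net.maxWeight (queues net A S t ω) ∂μ + totalQueue net.initQueue)) := by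
    intro t _
    have h1 : ∫ ω, (totalQueue (queues net A S t ω) : ℝ) ∂μ ≤ ∫ ω,
        N * (N * (net.maxWeight (queues net A S t ω) + totalQueue net.initQueue)) ∂μ := by
      refine integral_mono_ae (hqi t)
        ((((hwi t).add (integrable_const _)).const_mul _).const_mul _) ?_
      filter_upwards [hz] with ω hω
      exact net.totalQueue_queue_le hω t
    refine h1.trans (le_of_eq ?_)
    rw [integral_const_mul, integral_const_mul, integral_add (hwi t) (integrable_const _)]
    simp
  refine (Finset.sum_le_sum hq).trans ?_
  rw [← Finset.mul_sum, ← Finset.mul_sum, Finset.sum_add_distrib]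
  simp only [Finset.sum_const, Finset.card_range, nsmul_eq_mul]
  calc _ ≤ (N : ℝ) * (N * ((n * C + V₀) / 2 + n * totalQueue net.initQueue)) := by
        gcongr
        linarith [hsum n]
    _ = _ := by ring

end IsAdaptiveTassiulasRun

end

theorem corollary3 {N : ℕ} (net : Network N) (g : ℝ → ℝ) (hg : IsHysteresis g)
    (ε : ℝ) (hε : 0 < ε) (mem : TassiulasMemory) :
    ThroughputOptimal.{u} net (adaptiveTassiulas.{u} net g ε mem) := by
  rintro Ω _ μ _ A hA hbdd - hload S ⟨Z, Q, q₀, h⟩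
  exact h.stronglyStable hg hε hA hbdd hload
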